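/- Let $\Omega$ be a set, $\mathcal A$ an algebra of subsets of $\Omega$, $m$ a finitely additive probability on $\mathcal A$, $X$ a Banach space and $f:\Omega\to X$ any function. Conventions. For $E\subseteq\Omega$ put $m^*(E)=\inf\{m(A):A\in\mathcal A,\ E\subseteq A\}$, and let $\mathcal A(m)$ be the algebra of all $E\subseteq\Omega$ such that for every $\varepsilon>0$ there are $A,B\in\mathcal A$ with $A\subseteq E\subseteq B$ and $m(B\setminus A)<\varepsilon$. A function $g:\Omega\to\mathbb R$ is in $L^1(m)$ if there are $\mathcal A$-simple functions $g_n$ with $m^*(|g_n-g|>c)\to0$ for every $c>0$ and $\lim_{i,j}\int|g_i-g_j|\,dm=0$; then $\int g\,dm=\lim_n\int g_n\,dm$, and $\int_A g\,dm=\int g\mathbf 1_A\,dm$. The function $g$ is $m$-null on $A$ if $m^*(A\cap\{|g|>c\})=0$ for every $c>0$. For $H:\Omega\times X\to\mathbb R$ write $H(f)$ for the function $\omega\mapsto H(\omega,f(\omega))$. Let $$\Lambda(m,f)=\{H:\Omega\times X\to\mathbb R \;:\; H(f)\in L^1(m)\},\qquad \|H\|_{\Lambda(m,f)}=\int|H(f)|\,dm,$$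 and let $\Lambda_b(m,f)$ be the algebra of bounded functions in $\Lambda(m,f)$. Claim. There exist a compact Hausdorff space $S$, a regular (countably additive) Borel probability $\lambda$ on $S$, a Boolean homomorphism $\chi$ of $\mathcal A(m)$ into the algebra $\mathrm{clop}(S)$ of clopen subsets of $S$, and a linear map $T:\Lambda(m,f)\to L^1(\lambda)$, together with a choice for each $H$ of a function on $S$ in the class $T(H)$, again written $T(H)$, such that $T$ is isometric ($\|T(H)\|_{L^1(\lambda)}=\|H\|_{\Lambda(m,f)}$), is a lattice homomorphism ($T(H\vee G)=T(H)\vee T(G)$ in $L^1(\lambda)$), and $$\int_A H(f)\,dm=\int_{\chi(A)}T(H)\,d\lambda,\qquad A\in\mathcal A,\ H\in\Lambda(m,f).$$ In addition: (a) $T$ restricts to an isomorphism of algebras of $\Lambda_b(m,f)$ onto $C(S)$ (for $H\in\Lambda_b(m,f)$ the chosen function $T(H)$ is continuous, and equalities are pointwise on $S$); (b) each function in $C(S)$ is $\sigma(\mathrm{clop}(S))$-measurable; (c) for each $E\in\mathrm{clop}(S)$ there is $A\in\mathcal A(m)$ with $\lambda(E\,\triangle\,\chi(A))=0$; (d) $T[\Lambda(m,f)]$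 is norm dense in $L^1(\lambda)$; (e) for all $n\in\mathbb N$, $H_1,\dots,H_n\in\Lambda(m,f)$ and bounded continuous $\alpha:\mathbb R^n\to\mathbb R$ one has $\alpha(H_1,\dots,H_n)\in\Lambda(m,f)$ and $\alpha(T(H_1),\dots,T(H_n))=T(\alpha(H_1,\dots,H_n))$ $\lambda$-a.s.; (f) for each $A\in\mathcal A(m)$ and $H\in\Lambda(m,f)$, $H(f)$ is $m$-null on $A$ if and only if $T(H)=0$ $\lambda$-a.s. on $\chi(A)$; moreover $\lambda(\chi(A)\setminus\tilde A)=0$, where $$\tilde A=\chi(A)\cap\bigcap\big\{\{s\in S:T(H)(s)=0\}\;:\;H\in\Lambda(m,f),\ H(f)\text{ is } m\text{-null on }A\big\}.$$ -/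

import Mathlib

universe u v

open MeasureTheory Set Filter Topology
open scoped NNReal symmDiff

namespace FinAdd

variable {Ω : Type*} {𝒜 : Set (Set Ω)}

/-- The outer measure `m^*(E) = inf {m(A) : A ∈ 𝒜, E ⊆ A}` of a nonnegative finitely additive
set function `m` on `𝒜`. -/
noncomputable def outer (m : AddContent ℝ≥0 𝒜) (E : Set Ω) : ℝ :=
  sInf {r : ℝ | ∃ A ∈ 𝒜, E ⊆ A ∧ r = m A}

/-- The completion `𝒜(m)`: sets that can be squeezed between members of `𝒜` whose difference has
arbitrarily small `m`-measure. It is an algebra of sets. -/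
def completion (h𝒜 : IsSetAlgebra 𝒜) (m : AddContent ℝ≥0 𝒜) : BooleanSubalgebra (Set Ω) where
  carrier := {E | ∀ ε > (0 : ℝ), ∃ A ∈ 𝒜, ∃ B ∈ 𝒜, A ⊆ E ∧ E ⊆ B ∧ (m (B \ A) : ℝ) < ε}
  bot_mem' := fun ε hε => ⟨∅, h𝒜.empty_mem, ∅, h𝒜.empty_mem, by simp, by simp, by simpa using hε⟩
  compl_mem' := by
    intro E hE ε hε
    obtain ⟨A, hA, B, hB, hAE, hEB, h⟩ := hE ε hε
    refine ⟨Bᶜ, h𝒜.compl_mem hB, Aᶜ, h𝒜.compl_mem hA, compl_subset_compl.2 hEB,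
      compl_subset_compl.2 hAE, ?_⟩
    have : Aᶜ \ Bᶜ = B \ A := by ext; simp [and_comm]
    rwa [this]
  supClosed' := by
    intro E hE F hF ε hε
    obtain ⟨A, hA, B, hB, hAE, hEB, h⟩ := hE (ε / 2) (half_pos hε)
    obtain ⟨A', hA', B', hB', hAE', hEB', h'⟩ := hF (ε / 2) (half_pos hε)
    refine ⟨A ∪ A', h𝒜.union_mem hA hA', B ∪ B', h𝒜.union_mem hB hB',
      union_subset_union hAE hAE', union_subset_union hEB hEB', ?_⟩
    have h1 : m ((B ∪ B') \ (A ∪ A')) ≤ m ((B \ A) ∪ (B' \ A')) :=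
      addContent_mono h𝒜.isSetRing.isSetSemiring
        (h𝒜.sdiff_mem (h𝒜.union_mem hB hB') (h𝒜.union_mem hA hA'))
        (h𝒜.union_mem (h𝒜.sdiff_mem hB hA) (h𝒜.sdiff_mem hB' hA')) (by
          intro x; simp only [Set.mem_sdiff, mem_union]; tauto)
    have h2 := addContent_union_le (m := m) h𝒜.isSetRing (h𝒜.sdiff_mem hB hA)
      (h𝒜.sdiff_mem hB' hA')
    have h3 : (m ((B ∪ B') \ (A ∪ A')) : ℝ) ≤ m (B \ A) + m (B' \ A') := by
      exact_mod_cast h1.trans h2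
    linarith
  infClosed' := by
    intro E hE F hF ε hε
    obtain ⟨A, hA, B, hB, hAE, hEB, h⟩ := hE (ε / 2) (half_pos hε)
    obtain ⟨A', hA', B', hB', hAE', hEB', h'⟩ := hF (ε / 2) (half_pos hε)
    refine ⟨A ∩ A', h𝒜.inter_mem hA hA', B ∩ B', h𝒜.inter_mem hB hB',
      inter_subset_inter hAE hAE', inter_subset_inter hEB hEB', ?_⟩
    have h1 : m ((B ∩ B') \ (A ∩ A')) ≤ m ((B \ A) ∪ (B' \ A')) :=
      addContent_mono h𝒜.isSetRing.isSetSemiring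
        (h𝒜.sdiff_mem (h𝒜.inter_mem hB hB') (h𝒜.inter_mem hA hA'))
        (h𝒜.union_mem (h𝒜.sdiff_mem hB hA) (h𝒜.sdiff_mem hB' hA')) (by
          intro x; simp only [Set.mem_sdiff, mem_union, mem_inter_iff]; tauto)
    have h2 := addContent_union_le (m := m) h𝒜.isSetRing (h𝒜.sdiff_mem hB hA)
      (h𝒜.sdiff_mem hB' hA')
    have h3 : (m ((B ∩ B') \ (A ∩ A')) : ℝ) ≤ m (B \ A) + m (B' \ A') := by
      exact_mod_cast h1.trans h2
    linarith

theorem mem_completion (h𝒜 : IsSetAlgebra 𝒜) (m : AddContent ℝ≥0 𝒜) {A : Set Ω} (hA : A ∈ 𝒜) :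
    A ∈ completion h𝒜 m :=
  fun ε hε => ⟨A, hA, A, hA, Subset.rfl, Subset.rfl, by simpa using hε⟩

/-- `𝒜`-simple real functions: finitely many values, each taken on a member of `𝒜`. -/
def IsSimple (𝒜 : Set (Set Ω)) (s : Ω → ℝ) : Prop :=
  (range s).Finite ∧ ∀ x, s ⁻¹' {x} ∈ 𝒜

/-- The integral `∑ₓ x · m(s = x)` of an `𝒜`-simple function `s`. -/
noncomputable def simpleInt (m : AddContent ℝ≥0 𝒜) (s : Ω → ℝ) : ℝ :=
  ∑ᶠ x : ℝ, x * (m (s ⁻¹' {x}) : ℝ)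

/-- `s n` converges to `g` in `m`-measure: `m^*(|s n - g| > c) → 0` for every `c > 0`. -/
def TendstoInM (m : AddContent ℝ≥0 𝒜) (s : ℕ → Ω → ℝ) (g : Ω → ℝ) : Prop :=
  ∀ c > (0 : ℝ), Tendsto (fun n => outer m {ω | c < |s n ω - g ω|}) atTop (𝓝 0)

/-- `s` is a determining sequence for `g`: `𝒜`-simple functions which converge to `g` in
`m`-measure and satisfy `∫ |s i - s j| dm → 0` as `i, j → ∞`. -/
structure IsDetermining (m : AddContent ℝ≥0 𝒜) (s : ℕ → Ω → ℝ) (g : Ω → ℝ) : Prop where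
  simple : ∀ n, IsSimple 𝒜 (s n)
  tendsto : TendstoInM m s g
  cauchy : Tendsto (fun p : ℕ × ℕ => simpleInt m fun ω => |s p.1 ω - s p.2 ω|) atTop (𝓝 0)

/-- `g ∈ L¹(m)`. -/
def IsL1 (m : AddContent ℝ≥0 𝒜) (g : Ω → ℝ) : Prop :=
  ∃ s, IsDetermining m s g

/-- `g ∈ L¹(m)` and `∫ g dm = x`: the integral is the limit of the integrals of a determining
sequence. -/
def HasIntegral (m : AddContent ℝ≥0 𝒜) (g : Ω → ℝ) (x : ℝ) : Prop :=
  ∃ s, IsDetermining m s g ∧ Tendsto (fun n => simpleInt m (s n)) atTop (𝓝 x)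

/-- `g` is `m`-null on `A`: `m^*(A ∩ {|g| > c}) = 0` for every `c > 0`. -/
def NullOn (m : AddContent ℝ≥0 𝒜) (g : Ω → ℝ) (A : Set Ω) : Prop :=
  ∀ c > (0 : ℝ), outer m (A ∩ {ω | c < |g ω|}) = 0

/-! ### Elementary facts: `L¹(m)` is stable under Lipschitz operations -/

theorem outer_nonneg (m : AddContent ℝ≥0 𝒜) (E : Set Ω) : 0 ≤ outer m E :=
  Real.sInf_nonneg (by rintro _ ⟨A, -, -, rfl⟩; exact NNReal.coe_nonneg _)

theorem outer_le (m : AddContent ℝ≥0 𝒜) {E A : Set Ω} (hA : A ∈ 𝒜) (h : E ⊆ A) :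
    outer m E ≤ m A :=
  csInf_le ⟨0, by rintro _ ⟨A, -, -, rfl⟩; exact NNReal.coe_nonneg _⟩ ⟨A, hA, h, rfl⟩

theorem outer_le_add (h𝒜 : IsSetAlgebra 𝒜) (m : AddContent ℝ≥0 𝒜) {E F G : Set Ω}
    (h : E ⊆ F ∪ G) : outer m E ≤ outer m F + outer m G := by
  have ne : ∀ E : Set Ω, {r : ℝ | ∃ A ∈ 𝒜, E ⊆ A ∧ r = m A}.Nonempty :=
    fun E => ⟨_, univ, h𝒜.univ_mem, subset_univ _, rfl⟩
  refine le_of_forall_pos_le_add fun ε hε => ?_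
  obtain ⟨_, ⟨A, hA, hFA, rfl⟩, h1⟩ := Real.lt_sInf_add_pos (ne F) (half_pos hε)
  obtain ⟨_, ⟨B, hB, hGB, rfl⟩, h2⟩ := Real.lt_sInf_add_pos (ne G) (half_pos hε)
  have h3 := outer_le m (h𝒜.union_mem hA hB) (h.trans (union_subset_union hFA hGB))
  have h4 : (m (A ∪ B) : ℝ) ≤ m A + m B := by
    exact_mod_cast addContent_union_le (m := m) h𝒜.isSetRing hA hB
  change _ < outer m F + _ at h1
  change _ < outer m G + _ at h2
  linarith

theorem IsSimple.map₂ (h𝒜 : IsSetAlgebra 𝒜) {s t : Ω → ℝ} (hs : IsSimple 𝒜 s)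
    (ht : IsSimple 𝒜 t) (φ : ℝ → ℝ → ℝ) : IsSimple 𝒜 (fun ω => φ (s ω) (t ω)) := by
  classical
  refine ⟨(hs.1.image2 φ ht.1).subset ?_, fun x => ?_⟩
  · rintro _ ⟨ω, rfl⟩
    exact ⟨_, ⟨ω, rfl⟩, _, ⟨ω, rfl⟩, rfl⟩
  · have : (fun ω => φ (s ω) (t ω)) ⁻¹' {x} =
        ⋃ i ∈ (hs.1.toFinset ×ˢ ht.1.toFinset).filter (fun i => φ i.1 i.2 = x),
          s ⁻¹' {i.1} ∩ t ⁻¹' {i.2} := by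
      ext ω
      simp only [mem_preimage, mem_singleton_iff, mem_iUnion, mem_inter_iff, Finset.mem_filter,
        Finset.mem_product, Finite.mem_toFinset]
      constructor
      · intro h
        exact ⟨(s ω, t ω), ⟨⟨⟨ω, rfl⟩, ⟨ω, rfl⟩⟩, h⟩, rfl, rfl⟩
      · rintro ⟨i, ⟨-, h⟩, h1, h2⟩
        rw [h1, h2, h]
    rw [this]
    exact h𝒜.biUnion_mem _ fun i _ => h𝒜.inter_mem (hs.2 _) (ht.2 _)

/-- The integral of a simple function may be computed over any finite partition on whose cells it
is constant. -/
theorem simpleInt_comp (h𝒜 : IsSetAlgebra 𝒜) (m : AddContent ℝ≥0 𝒜) {ι : Type*} [DecidableEq ι]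
    (t : Finset ι) (p : Ω → ι) (hp : ∀ ω, p ω ∈ t) (hm : ∀ i, p ⁻¹' {i} ∈ 𝒜) (c : ι → ℝ) :
    simpleInt m (fun ω => c (p ω)) = ∑ i ∈ t, c i * (m (p ⁻¹' {i}) : ℝ) := by
  have hsub : Function.support
      (fun x : ℝ => x * (m ((fun ω => c (p ω)) ⁻¹' {x}) : ℝ)) ⊆ (t.image c : Finset ℝ) := by
    intro x hx
    by_contra hxt
    apply hx
    have : (fun ω => c (p ω)) ⁻¹' {x} = ∅ := by
      ext ω
      simp only [mem_preimage, mem_singleton_iff, mem_empty_iff_false, iff_false]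
      rintro rfl
      exact hxt (by simpa using ⟨p ω, hp ω, rfl⟩)
    simp [this]
  rw [simpleInt, finsum_eq_sum_of_support_subset _ hsub,
    ← Finset.sum_fiberwise_of_maps_to (s := t) (t := t.image c) (g := c)
      (fun i hi => Finset.mem_image_of_mem c hi)]
  refine Finset.sum_congr rfl fun x _ => ?_
  have hU : (fun ω => c (p ω)) ⁻¹' {x} = ⋃ i ∈ t.filter (fun i => c i = x), p ⁻¹' {i} := by
    ext ω; simp [hp]
  rw [hU, addContent_biUnion (fun i _ => hm i)
    (fun i _ j _ hij => Disjoint.preimage p (by simpa using hij))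
    (h𝒜.biUnion_mem _ fun i _ => hm i)]
  push_cast
  rw [Finset.mul_sum]
  exact Finset.sum_congr rfl fun i hi => by rw [(Finset.mem_filter.1 hi).2]

theorem simpleInt_le (h𝒜 : IsSetAlgebra 𝒜) (m : AddContent ℝ≥0 𝒜) {a b c : Ω → ℝ}
    (ha : IsSimple 𝒜 a) (hb : IsSimple 𝒜 b) (hc : IsSimple 𝒜 c) (K : ℝ)
    (h : ∀ ω, c ω ≤ K * (a ω + b ω)) :
    simpleInt m c ≤ K * (simpleInt m a + simpleInt m b) := by
  classical
  let p : Ω → ℝ × ℝ × ℝ := fun ω => (a ω, b ω, c ω)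
  let t := ha.1.toFinset ×ˢ hb.1.toFinset ×ˢ hc.1.toFinset
  have hp : ∀ ω, p ω ∈ t := fun ω => by simp [p, t]
  have hm : ∀ i, p ⁻¹' {i} ∈ 𝒜 := fun i => by
    have : p ⁻¹' {i} = a ⁻¹' {i.1} ∩ (b ⁻¹' {i.2.1} ∩ c ⁻¹' {i.2.2}) := by
      ext ω; simp [p, Prod.ext_iff]
    rw [this]
    exact h𝒜.inter_mem (ha.2 _) (h𝒜.inter_mem (hb.2 _) (hc.2 _))
  have e1 := simpleInt_comp h𝒜 m t p hp hm (fun i => i.1)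
  have e2 := simpleInt_comp h𝒜 m t p hp hm (fun i => i.2.1)
  have e3 := simpleInt_comp h𝒜 m t p hp hm (fun i => i.2.2)
  change simpleInt m a = _ at e1
  change simpleInt m b = _ at e2
  change simpleInt m c = _ at e3
  rw [e1, e2, e3, ← Finset.sum_add_distrib, Finset.mul_sum]
  refine Finset.sum_le_sum fun i _ => ?_
  rcases (p ⁻¹' {i}).eq_empty_or_nonempty with h0 | ⟨ω, hω⟩
  · simp [h0]
  · obtain rfl : p ω = i := hω
    have := mul_le_mul_of_nonneg_right (h ω) (NNReal.coe_nonneg (m (p ⁻¹' {p ω})))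
    calc _ ≤ _ := this
      _ = _ := by simp only [p]; ring

theorem simpleInt_nonneg (m : AddContent ℝ≥0 𝒜) {a : Ω → ℝ} (h : ∀ ω, 0 ≤ a ω) :
    0 ≤ simpleInt m a := by
  refine finsum_nonneg fun x => ?_
  rcases (a ⁻¹' {x}).eq_empty_or_nonempty with h0 | ⟨ω, hω⟩
  · simp [h0]
  · obtain rfl : a ω = x := hω
    exact mul_nonneg (h ω) (NNReal.coe_nonneg _)

theorem IsL1.map₂ (h𝒜 : IsSetAlgebra 𝒜) {m : AddContent ℝ≥0 𝒜} {f g : Ω → ℝ} (hf : IsL1 m f)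
    (hg : IsL1 m g) (φ : ℝ → ℝ → ℝ) (K : ℝ) (hK : 0 < K)
    (hφ : ∀ a b a' b', |φ a b - φ a' b'| ≤ K * (|a - a'| + |b - b'|)) :
    IsL1 m (fun ω => φ (f ω) (g ω)) := by
  obtain ⟨s, hs⟩ := hf
  obtain ⟨t, ht⟩ := hg
  refine ⟨fun n ω => φ (s n ω) (t n ω), fun n => (hs.simple n).map₂ h𝒜 (ht.simple n) φ, ?_, ?_⟩
  · intro c hc
    have hc' : 0 < c / (2 * K) := by positivity
    have := (hs.tendsto _ hc').add (ht.tendsto _ hc')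
    rw [add_zero] at this
    refine squeeze_zero (fun n => outer_nonneg _ _) (fun n => outer_le_add h𝒜 m ?_) this
    intro ω hω
    by_contra hn
    simp only [mem_union, mem_ofPred_eq, not_or, not_lt] at hn hω
    have h1 := hφ (s n ω) (t n ω) (f ω) (g ω)
    have h2 : K * (|s n ω - f ω| + |t n ω - g ω|) ≤ K * (c / (2 * K) + c / (2 * K)) := by
      gcongr <;> tauto
    have h3 : K * (c / (2 * K) + c / (2 * K)) = c := by field_simp; norm_num
    linarith
  · have := (hs.cauchy.add ht.cauchy).const_mul K
    rw [add_zero, mul_zero] at this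
    refine squeeze_zero (fun n => simpleInt_nonneg _ fun _ => abs_nonneg _) (fun n => ?_) this
    exact simpleInt_le h𝒜 m ((hs.simple _).map₂ h𝒜 (hs.simple _) fun a b => |a - b|)
      ((ht.simple _).map₂ h𝒜 (ht.simple _) fun a b => |a - b|)
      (((hs.simple n.1).map₂ h𝒜 (ht.simple n.1) φ).map₂ h𝒜
        ((hs.simple n.2).map₂ h𝒜 (ht.simple n.2) φ) fun a b => |a - b|) K
      (fun ω => hφ _ _ _ _)

theorem isL1_const (h𝒜 : IsSetAlgebra 𝒜) (m : AddContent ℝ≥0 𝒜) (c : ℝ) :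
    IsL1 m (fun _ => c) := by
  have h0 : outer m (∅ : Set Ω) = 0 :=
    le_antisymm (by simpa using outer_le m h𝒜.empty_mem Subset.rfl) (outer_nonneg _ _)
  refine ⟨fun _ _ => c, fun _ => ⟨(finite_singleton c).subset ?_, fun x => ?_⟩, ?_, ?_⟩
  · rintro _ ⟨_, rfl⟩; rfl
  · by_cases h : c = x
    · simpa [h, preimage_const_of_mem] using h𝒜.univ_mem
    · simpa [h] using h𝒜.empty_mem
  · intro d hd
    have : ∀ ω : Ω, ¬ d < |c - c| := fun _ => by simpa using hd.le
    simp [hd.not_gt, h0]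
  · have : simpleInt m (fun _ : Ω => (0 : ℝ)) = 0 := by
      unfold simpleInt
      rw [← finsum_zero]
      congr 1
      ext x
      by_cases h : 0 = x
      · simp [← h]
      · simp [h]
    simp [this]

/-! ### The spaces `Λ(m, f)` and `Λ_b(m, f)` -/

variable {X : Type*}

/-- `H(f)`, the function `ω ↦ H(ω, f(ω))`. -/
def along (f : Ω → X) (H : Ω × X → ℝ) : Ω → ℝ := fun ω => H (ω, f ω)

/-- The vector space `Λ(m, f)` of all `H : Ω × X → ℝ` with `H(f) ∈ L¹(m)`. -/
def Lam (h𝒜 : IsSetAlgebra 𝒜) (m : AddContent ℝ≥0 𝒜) (f : Ω → X) :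
    Submodule ℝ (Ω × X → ℝ) where
  carrier := {H | IsL1 m (along f H)}
  zero_mem' := isL1_const h𝒜 m 0
  add_mem' := fun hH hG => hH.map₂ h𝒜 hG (fun a b => a + b) 1 one_pos fun a b a' b' => by
    rw [one_mul]
    calc _ = |(a - a') + (b - b')| := by ring_nf
      _ ≤ _ := abs_add_le _ _
  smul_mem' := fun c H hH => IsL1.map₂ h𝒜 hH hH (fun a _ => c * a) (|c| + 1) (by positivity)
    fun a b a' b' => by
      rw [← mul_sub, abs_mul]
      gcongr
      · linarith
      · linarith [abs_nonneg (b - b')]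

/-- The algebra `Λ_b(m, f)` of bounded elements of `Λ(m, f)`. -/
def LamB (h𝒜 : IsSetAlgebra 𝒜) (m : AddContent ℝ≥0 𝒜) (f : Ω → X) :
    Subalgebra ℝ (Ω × X → ℝ) where
  carrier := {H | H ∈ Lam h𝒜 m f ∧ ∃ C : ℝ, ∀ p, |H p| ≤ C}
  algebraMap_mem' := fun c => ⟨isL1_const h𝒜 m c, |c|, fun _ => le_rfl⟩
  add_mem' := by
    rintro H G ⟨hH, C, hC⟩ ⟨hG, D, hD⟩
    exact ⟨(Lam h𝒜 m f).add_mem hH hG, C + D,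
      fun p => (abs_add_le _ _).trans (add_le_add (hC p) (hD p))⟩
  mul_mem' := by
    rintro H G ⟨hH, C, hC⟩ ⟨hG, D, hD⟩
    refine ⟨?_, C * D, fun p => ?_⟩
    · -- multiply after truncation at a level which bounds both functions
      let M : ℝ := max (max C D) 1
      have hM : 0 < M := lt_of_lt_of_le one_pos (le_max_right _ _)
      let cl : ℝ → ℝ := fun a => max (-M) (min M a)
      have hcl : ∀ a, |cl a| ≤ M := fun a => by
        rw [abs_le]
        exact ⟨le_max_left _ _, max_le (by linarith) (min_le_left _ _)⟩
      have hlip : ∀ a b, |cl a - cl b| ≤ |a - b| := fun a b => by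
        refine (abs_max_sub_max_le_max _ _ _ _).trans ?_
        rw [sub_self, abs_zero]
        refine max_le (abs_nonneg _) ((abs_min_sub_min_le_max _ _ _ _).trans ?_)
        simp
      have hid : ∀ a, |a| ≤ M → cl a = a := fun a ha => by
        rw [abs_le] at ha
        simp only [cl]
        rw [min_eq_right ha.2, max_eq_right ha.1]
      have key := IsL1.map₂ h𝒜 hH hG (fun a b => cl a * cl b) M hM fun a b a' b' => by
        calc |cl a * cl b - cl a' * cl b'|
            = |(cl a - cl a') * cl b + cl a' * (cl b - cl b')| := by ring_nf
          _ ≤ |cl a - cl a'| * |cl b| + |cl a'| * |cl b - cl b'| := by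
            rw [← abs_mul, ← abs_mul]; exact abs_add_le _ _
          _ ≤ |a - a'| * M + M * |b - b'| := by
            exact add_le_add
              (mul_le_mul (hlip _ _) (hcl _) (abs_nonneg _) (abs_nonneg _))
              (mul_le_mul (hcl _) (hlip _ _) (abs_nonneg _) hM.le)
          _ = M * (|a - a'| + |b - b'|) := by ring
      have e : (fun ω => cl (along f H ω) * cl (along f G ω)) = along f (H * G) := by
        ext ω
        rw [hid (along f H ω) ((hC _).trans ((le_max_left _ _).trans (le_max_left _ _))),
          hid (along f G ω) ((hD _).trans ((le_max_right _ _).trans (le_max_left _ _)))]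
        rfl
      rw [e] at key
      exact key
    · rw [Pi.mul_apply, abs_mul]
      exact mul_le_mul (hC p) (hD p) (abs_nonneg _) ((abs_nonneg _).trans (hC p))

theorem sup_mem_Lam (h𝒜 : IsSetAlgebra 𝒜) (m : AddContent ℝ≥0 𝒜) (f : Ω → X)
    {H G : Ω × X → ℝ} (hH : H ∈ Lam h𝒜 m f) (hG : G ∈ Lam h𝒜 m f) : H ⊔ G ∈ Lam h𝒜 m f :=
  IsL1.map₂ h𝒜 hH hG (fun a b => max a b) 1 one_pos fun a b a' b' => by
    rw [one_mul]
    exact (abs_max_sub_max_le_max _ _ _ _).trans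
      (max_le_add_of_nonneg (abs_nonneg _) (abs_nonneg _))

end FinAdd

/-! The algebra Λ_b(m, f) consists of bounded functions on Ω × X and is closed under uniform limits.
Let S be the closure of Ω × X in ℝ^{Λ_b} under evaluation. Then S is compact, and by
Stone–Weierstrass (`gel_bijective`) evaluation identifies Λ_b with C(S). The functional H ↦ ∫ H(f)
dm is positive on C(S), so Riesz gives a regular probability λ (`exists_representing_measure`).
Countable additivity is thus gained by compactness.

Since |H| corresponds to its absolute value on S, Λ_b maps isometrically into L¹(λ). If s_n
determines H(f), the classes of s_n are Cauchy in L¹(λ), and T(H) is their limit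
(`exists_extension`). Lattice operations, integrals over A and bounded continuous α pass to the
limit; null sets follow from these and the isometry.

The homomorphism χ sends A to the clopen set where the continuous function attached to 1_A equals 1.
For (b), all but countably many levels of a continuous function are λ-null, and cutting at a null
level gives a clopen set (`exists_clopen_between`). For (c), a {0,1}-valued H and the indicator of
{H(f) = 1} agree along f, hence λ-a.e., although they may differ elsewhere on Ω × X. The last claim
of (f) involves an uncountable union of null sets, but truncation makes these sets open, and
regularity of λ applies. -/

namespace FinAdd

/-! ### Integration with respect to a finitely additive probability. -/

section Integral

variable {Ω : Type*} {𝒜 : Set (Set Ω)} {m : AddContent ℝ≥0 𝒜}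

/-! ### The outer measure -/

theorem outer_mono (h𝒜 : IsSetAlgebra 𝒜) {E F : Set Ω} (h : E ⊆ F) : outer m E ≤ outer m F := by
  have h0 : outer m (∅ : Set Ω) ≤ 0 := by simpa using outer_le m h𝒜.empty_mem Subset.rfl
  linarith [outer_le_add h𝒜 m (h.trans (subset_union_left (t := ∅)))]

theorem measure_mono (h𝒜 : IsSetAlgebra 𝒜) {A B : Set Ω} (hA : A ∈ 𝒜) (hB : B ∈ 𝒜)
    (h : A ⊆ B) : (m A : ℝ) ≤ m B := by
  exact_mod_cast addContent_mono h𝒜.isSetRing.isSetSemiring hA hB h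

theorem exists_cover (h𝒜 : IsSetAlgebra 𝒜) {E : Set Ω} {ε : ℝ} (h : outer m E < ε) :
    ∃ A ∈ 𝒜, E ⊆ A ∧ (m A : ℝ) < ε := by
  have ne : {r : ℝ | ∃ A ∈ 𝒜, E ⊆ A ∧ r = m A}.Nonempty := ⟨_, univ, h𝒜.univ_mem, subset_univ _, rfl⟩
  obtain ⟨_, ⟨A, hA, hE, rfl⟩, h1⟩ := exists_lt_of_csInf_lt ne h
  exact ⟨A, hA, hE, h1⟩

theorem le_outer (h𝒜 : IsSetAlgebra 𝒜) {A E : Set Ω} (hA : A ∈ 𝒜) (h : A ⊆ E) :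
    (m A : ℝ) ≤ outer m E := by
  refine le_of_forall_pos_lt_add fun ε hε => ?_
  obtain ⟨B, hB, hE, h1⟩ := exists_cover (m := m) h𝒜 (lt_add_of_pos_right (outer m E) hε)
  exact (measure_mono h𝒜 hA hB (h.trans hE)).trans_lt h1

/-! ### Simple functions -/

theorem isSimple_const (h𝒜 : IsSetAlgebra 𝒜) (c : ℝ) : IsSimple 𝒜 (fun _ => c) := by
  refine ⟨(finite_singleton c).subset ?_, fun x => ?_⟩
  · rintro _ ⟨_, rfl⟩; rfl
  · by_cases h : c = x
    · simpa [h, preimage_const_of_mem] using h𝒜.univ_mem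
    · simpa [h] using h𝒜.empty_mem

theorem IsSimple.map (h𝒜 : IsSetAlgebra 𝒜) {s : Ω → ℝ} (hs : IsSimple 𝒜 s) (φ : ℝ → ℝ) :
    IsSimple 𝒜 (fun ω => φ (s ω)) :=
  hs.map₂ h𝒜 hs fun a _ => φ a

theorem IsSimple.preimage_mem (h𝒜 : IsSetAlgebra 𝒜) {s : Ω → ℝ} (hs : IsSimple 𝒜 s) (P : Set ℝ) :
    s ⁻¹' P ∈ 𝒜 := by
  classical
  have : s ⁻¹' P = ⋃ x ∈ hs.1.toFinset.filter (· ∈ P), s ⁻¹' {x} := by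
    ext ω; simp
  rw [this]
  exact h𝒜.biUnion_mem _ fun x _ => hs.2 x

theorem isSimple_indicator (h𝒜 : IsSetAlgebra 𝒜) {A : Set Ω} (hA : A ∈ 𝒜) {s : Ω → ℝ}
    (hs : IsSimple 𝒜 s) : IsSimple 𝒜 (A.indicator s) := by
  refine ⟨(hs.1.union (finite_singleton 0)).subset ?_, fun x => ?_⟩
  · rintro _ ⟨ω, rfl⟩
    by_cases h : ω ∈ A <;> simp [h]
  · have : A.indicator s ⁻¹' {x} = (A ∩ s ⁻¹' {x}) ∪ (Aᶜ ∩ (fun _ => (0 : ℝ)) ⁻¹' {x}) := by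
      ext ω
      by_cases h : ω ∈ A <;> simp [h]
    rw [this]
    exact h𝒜.union_mem (h𝒜.inter_mem hA (hs.2 x))
      (h𝒜.inter_mem (h𝒜.compl_mem hA) ((isSimple_const h𝒜 0).2 x))

theorem IsSimple.pi {n : ℕ} (h𝒜 : IsSetAlgebra 𝒜) {s : Fin n → Ω → ℝ}
    (hs : ∀ i, IsSimple 𝒜 (s i)) (α : (Fin n → ℝ) → ℝ) :
    IsSimple 𝒜 (fun ω => α fun i => s i ω) := by
  classical
  have hfin : (range fun ω => fun i => s i ω).Finite :=
    (Finite.pi' fun i => (hs i).1).subset (by rintro _ ⟨ω, rfl⟩ i; exact ⟨ω, rfl⟩)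
  refine ⟨(hfin.image α).subset (by rintro _ ⟨ω, rfl⟩; exact ⟨_, ⟨ω, rfl⟩, rfl⟩), fun x => ?_⟩
  have : (fun ω => α fun i => s i ω) ⁻¹' {x} =
      ⋃ v ∈ hfin.toFinset.filter (fun v => α v = x),
        ⋂ i ∈ (Finset.univ : Finset (Fin n)), s i ⁻¹' {v i} := by
    ext ω
    simp only [mem_preimage, mem_singleton_iff, mem_iUnion, mem_iInter, Finset.mem_filter,
      Finite.mem_toFinset, exists_prop]
    constructor
    · intro h
      exact ⟨_, ⟨⟨ω, rfl⟩, h⟩, fun i _ => rfl⟩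
    · rintro ⟨v, ⟨-, h⟩, h1⟩
      rw [← h]
      congr 1
      ext i
      exact h1 i (Finset.mem_univ i)
  rw [this]
  refine h𝒜.biUnion_mem _ fun v _ => ?_
  have hbi : ∀ t : Finset (Fin n), (⋂ i ∈ t, s i ⁻¹' {v i}) ∈ 𝒜 := fun t => by
    induction t using Finset.induction_on with
    | empty => simpa using h𝒜.univ_mem
    | insert i t _ ih =>
      rw [Finset.set_biInter_insert]
      exact h𝒜.inter_mem ((hs i).2 _) ih
  exact hbi _

theorem IsSimple.exists_bound {s : Ω → ℝ} (hs : IsSimple 𝒜 s) : ∃ M, 0 ≤ M ∧ ∀ ω, |s ω| ≤ M := by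
  obtain ⟨M, hM⟩ := (hs.1.image abs).bddAbove
  exact ⟨max M 0, le_max_right _ _, fun ω => (hM ⟨_, ⟨ω, rfl⟩, rfl⟩).trans (le_max_left _ _)⟩

/-- All three functions are constant on the cells where the pair (a, b) is constant, so the
integrals become sums over one partition. -/
theorem simpleInt_linear (h𝒜 : IsSetAlgebra 𝒜) {a b : Ω → ℝ} (ha : IsSimple 𝒜 a)
    (hb : IsSimple 𝒜 b) (x y : ℝ) :
    simpleInt m (fun ω => x * a ω + y * b ω) = x * simpleInt m a + y * simpleInt m b := by
  classical
  let p : Ω → ℝ × ℝ := fun ω => (a ω, b ω)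
  let t := ha.1.toFinset ×ˢ hb.1.toFinset
  have hp : ∀ ω, p ω ∈ t := fun ω => by simp [p, t]
  have hm : ∀ i, p ⁻¹' {i} ∈ 𝒜 := fun i => by
    have : p ⁻¹' {i} = a ⁻¹' {i.1} ∩ b ⁻¹' {i.2} := by
      ext ω; simp [p, Prod.ext_iff]
    rw [this]
    exact h𝒜.inter_mem (ha.2 _) (hb.2 _)
  have e1 := simpleInt_comp h𝒜 m t p hp hm (fun i => i.1)
  have e2 := simpleInt_comp h𝒜 m t p hp hm (fun i => i.2)
  have e3 := simpleInt_comp h𝒜 m t p hp hm (fun i => x * i.1 + y * i.2)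
  change simpleInt m a = _ at e1
  change simpleInt m b = _ at e2
  change simpleInt m (fun ω => x * a ω + y * b ω) = _ at e3
  rw [e1, e2, e3, Finset.mul_sum, Finset.mul_sum, ← Finset.sum_add_distrib]
  exact Finset.sum_congr rfl fun i _ => by ring

theorem simpleInt_mono (h𝒜 : IsSetAlgebra 𝒜) {a b : Ω → ℝ} (ha : IsSimple 𝒜 a)
    (hb : IsSimple 𝒜 b) (h : ∀ ω, a ω ≤ b ω) : simpleInt m a ≤ simpleInt m b := by
  have h1 := simpleInt_linear (m := m) h𝒜 hb ha 1 (-1)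
  have h2 : 0 ≤ simpleInt m (fun ω => 1 * b ω + -1 * a ω) :=
    simpleInt_nonneg m fun ω => by linarith [h ω]
  linarith

theorem simpleInt_const (h𝒜 : IsSetAlgebra 𝒜) (hm : m univ = 1) (c : ℝ) :
    simpleInt m (fun _ : Ω => c) = c := by
  have := simpleInt_comp h𝒜 m {()} (fun _ : Ω => ()) (by simp) (by
    intro i; simpa using h𝒜.univ_mem) (fun _ => c)
  simpa [hm] using this

theorem simpleInt_indicator_one (A : Set Ω) :
    simpleInt m (A.indicator fun _ => 1) = m A := by
  have h1 : A.indicator (fun _ => (1 : ℝ)) ⁻¹' {1} = A := by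
    ext ω; by_cases h : ω ∈ A <;> simp [h]
  rw [simpleInt, finsum_eq_single _ 1, h1, one_mul]
  intro x hx
  by_cases hx0 : x = 0
  · simp [hx0]
  · have : A.indicator (fun _ => (1 : ℝ)) ⁻¹' {x} = ∅ := by
      ext ω; by_cases h : ω ∈ A <;> simp [h, Ne.symm hx, Ne.symm hx0]
    simp [this]

theorem abs_simpleInt_sub_le (h𝒜 : IsSetAlgebra 𝒜) {a b : Ω → ℝ} (ha : IsSimple 𝒜 a)
    (hb : IsSimple 𝒜 b) :
    |simpleInt m a - simpleInt m b| ≤ simpleInt m fun ω => |a ω - b ω| := by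
  have hab := ha.map₂ h𝒜 hb fun x y => |x - y|
  have h1 := simpleInt_linear (m := m) h𝒜 hb hab 1 1
  have h2 := simpleInt_linear (m := m) h𝒜 ha hab 1 1
  have h3 := simpleInt_mono (m := m) h𝒜 ha (hb.map₂ h𝒜 hab fun x y => 1 * x + 1 * y)
    fun ω => by linarith [le_abs_self (a ω - b ω)]
  have h4 := simpleInt_mono (m := m) h𝒜 hb (ha.map₂ h𝒜 hab fun x y => 1 * x + 1 * y)
    fun ω => by linarith [neg_abs_le (a ω - b ω)]
  rw [abs_le]
  constructor <;> linarith

/-- Chebyshev's inequality for simple functions. -/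
theorem mul_measure_le_simpleInt (h𝒜 : IsSetAlgebra 𝒜) {a : Ω → ℝ} (ha : IsSimple 𝒜 a) (c : ℝ) :
    c * m {ω | c < |a ω|} ≤ simpleInt m fun ω => |a ω| := by
  have hA : {ω | c < |a ω|} ∈ 𝒜 := ha.preimage_mem h𝒜 {x | c < |x|}
  have h1 := isSimple_indicator h𝒜 hA (isSimple_const h𝒜 1)
  have h2 := simpleInt_linear (m := m) h𝒜 h1 h1 c 0
  rw [simpleInt_indicator_one] at h2
  have h3 := simpleInt_mono (m := m) h𝒜 (h1.map₂ h𝒜 h1 fun x y => c * x + 0 * y)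
    (ha.map h𝒜 abs) fun ω => by
      by_cases h : c < |a ω|
      · simp [h, h.le]
      · simp [h]
  linarith

/-- Split at level c: where |a| ≤ c the contribution is at most c because the total mass is 1, and
elsewhere the bound b + C is used. This replaces dominated convergence in what follows. -/
theorem simpleInt_abs_le (h𝒜 : IsSetAlgebra 𝒜) (hm : m univ = 1) {a b : Ω → ℝ}
    (ha : IsSimple 𝒜 a) (hb : IsSimple 𝒜 b) (hb0 : ∀ ω, 0 ≤ b ω) {c C : ℝ} (hc : 0 ≤ c)
    (h : ∀ ω, |a ω| ≤ b ω + C) :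
    simpleInt m (fun ω => |a ω|) ≤ c + simpleInt m b + C * m {ω | c < |a ω|} := by
  have hA : {ω | c < |a ω|} ∈ 𝒜 := ha.preimage_mem h𝒜 {x | c < |x|}
  have h1 := isSimple_indicator h𝒜 hA (isSimple_const h𝒜 1)
  have h2 := simpleInt_linear (m := m) h𝒜 hb h1 1 C
  have h2s := hb.map₂ h𝒜 h1 fun x y => 1 * x + C * y
  have h4 := simpleInt_linear (m := m) h𝒜 (isSimple_const h𝒜 c) h2s 1 1
  rw [simpleInt_indicator_one] at h2
  rw [simpleInt_const h𝒜 hm] at h4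
  have h3 := simpleInt_mono (m := m) h𝒜 (ha.map h𝒜 abs)
    ((isSimple_const h𝒜 c).map₂ h𝒜 h2s fun x y => 1 * x + 1 * y) fun ω => by
      by_cases h' : c < |a ω|
      · simp [h']; linarith [h ω]
      · simp [h']; linarith [hb0 ω]
  linarith

/-! ### Determining sequences -/

/-- A form of `IsL1.map₂` that keeps the determining sequence explicit, since both the integral and
T are limits along such sequences. -/
theorem IsDetermining.map₂ (h𝒜 : IsSetAlgebra 𝒜) {s t : ℕ → Ω → ℝ} {f g : Ω → ℝ}
    (hs : IsDetermining m s f) (ht : IsDetermining m t g) (φ : ℝ → ℝ → ℝ) (K : ℝ) (hK : 0 < K)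
    (hφ : ∀ a b a' b', |φ a b - φ a' b'| ≤ K * (|a - a'| + |b - b'|)) :
    IsDetermining m (fun n ω => φ (s n ω) (t n ω)) (fun ω => φ (f ω) (g ω)) := by
  refine ⟨fun n => (hs.simple n).map₂ h𝒜 (ht.simple n) φ, ?_, ?_⟩
  · intro c hc
    have hc' : 0 < c / (2 * K) := by positivity
    have := (hs.tendsto _ hc').add (ht.tendsto _ hc')
    rw [add_zero] at this
    refine squeeze_zero (fun n => outer_nonneg _ _) (fun n => outer_le_add h𝒜 m ?_) this
    intro ω hω
    by_contra hn
    simp only [mem_union, mem_ofPred_eq, not_or, not_lt] at hn hω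
    have h1 := hφ (s n ω) (t n ω) (f ω) (g ω)
    have h2 : K * (|s n ω - f ω| + |t n ω - g ω|) ≤ K * (c / (2 * K) + c / (2 * K)) := by
      gcongr <;> tauto
    have h3 : K * (c / (2 * K) + c / (2 * K)) = c := by field_simp; norm_num
    linarith
  · have := (hs.cauchy.add ht.cauchy).const_mul K
    rw [add_zero, mul_zero] at this
    refine squeeze_zero (fun n => simpleInt_nonneg _ fun _ => abs_nonneg _) (fun n => ?_) this
    exact simpleInt_le h𝒜 m ((hs.simple _).map₂ h𝒜 (hs.simple _) fun a b => |a - b|)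
      ((ht.simple _).map₂ h𝒜 (ht.simple _) fun a b => |a - b|)
      (((hs.simple n.1).map₂ h𝒜 (ht.simple n.1) φ).map₂ h𝒜
        ((hs.simple n.2).map₂ h𝒜 (ht.simple n.2) φ) fun a b => |a - b|) K
      (fun ω => hφ _ _ _ _)

theorem IsDetermining.linear (h𝒜 : IsSetAlgebra 𝒜) {s t : ℕ → Ω → ℝ} {f g : Ω → ℝ}
    (hs : IsDetermining m s f) (ht : IsDetermining m t g) (x y : ℝ) :
    IsDetermining m (fun n ω => x * s n ω + y * t n ω) (fun ω => x * f ω + y * g ω) := by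
  refine hs.map₂ h𝒜 ht (fun a b => x * a + y * b) (|x| + |y| + 1) (by positivity)
    fun a b a' b' => ?_
  calc |x * a + y * b - (x * a' + y * b')| = |x * (a - a') + y * (b - b')| := by ring_nf
    _ ≤ |x| * |a - a'| + |y| * |b - b'| := by
      rw [← abs_mul, ← abs_mul]; exact abs_add_le _ _
    _ ≤ _ := by
      nlinarith [abs_nonneg x, abs_nonneg y, abs_nonneg (a - a'), abs_nonneg (b - b'),
        mul_nonneg (abs_nonneg x) (abs_nonneg (b - b')),
        mul_nonneg (abs_nonneg y) (abs_nonneg (a - a'))]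

theorem IsDetermining.abs_sub (h𝒜 : IsSetAlgebra 𝒜) {s t : ℕ → Ω → ℝ} {f g : Ω → ℝ}
    (hs : IsDetermining m s f) (ht : IsDetermining m t g) :
    IsDetermining m (fun n ω => |s n ω - t n ω|) (fun ω => |f ω - g ω|) :=
  hs.map₂ h𝒜 ht (fun a b => |a - b|) 1 one_pos fun a b a' b' => by
    rw [one_mul]
    refine (abs_abs_sub_abs_le_abs_sub _ _).trans ?_
    calc _ = |(a - a') - (b - b')| := by ring_nf
      _ ≤ _ := _root_.abs_sub _ _

theorem IsDetermining.abs (h𝒜 : IsSetAlgebra 𝒜) {s : ℕ → Ω → ℝ} {f : Ω → ℝ}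
    (hs : IsDetermining m s f) : IsDetermining m (fun n ω => |s n ω|) (fun ω => |f ω|) :=
  hs.map₂ h𝒜 hs (fun a _ => |a|) 1 one_pos fun a b a' b' => by
    rw [one_mul]
    exact (abs_abs_sub_abs_le_abs_sub _ _).trans (le_add_of_nonneg_right (abs_nonneg _))

theorem IsSimple.isDetermining (h𝒜 : IsSetAlgebra 𝒜) (hm : m univ = 1) {s : Ω → ℝ}
    (hs : IsSimple 𝒜 s) : IsDetermining m (fun _ => s) s := by
  refine ⟨fun _ => hs, fun c hc => ?_, ?_⟩
  · have : {ω | c < |s ω - s ω|} = ∅ := by ext; simp [hc.le]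
    have h0 : outer m (∅ : Set Ω) = 0 :=
      le_antisymm (by simpa using outer_le m h𝒜.empty_mem Subset.rfl) (outer_nonneg _ _)
    simp only [this, h0]
    exact tendsto_const_nhds
  · simp [simpleInt_const h𝒜 hm]

/-- A sequence determining the zero function converges to it in mean. -/
theorem IsDetermining.tendsto_simpleInt_abs_zero (h𝒜 : IsSetAlgebra 𝒜) (hm : m univ = 1)
    {s : ℕ → Ω → ℝ} {g : Ω → ℝ} (hs : IsDetermining m s g) (hg : ∀ ω, g ω = 0) :
    Tendsto (fun n => simpleInt m fun ω => |s n ω|) atTop (𝓝 0) := by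
  rw [Metric.tendsto_atTop]
  intro ε hε
  obtain ⟨⟨N, N'⟩, hN⟩ := (hs.cauchy.eventually_lt_const (show 0 < ε / 4 by positivity)).exists_forall_of_atTop
  -- Compare s_n with the single bounded function s_k. The mean of |s_n| is then at most a sum of
  -- three terms of size ε/4: the cutoff level, the mean of |s_n - s_k|, and M times the measure of
  -- {|s_n| > ε/4}, which is small as s_n → 0 in measure.
  set k := max N N'
  obtain ⟨M, hM0, hM⟩ := (hs.simple k).exists_bound
  have hδ : 0 < ε / (4 * (M + 1)) := by positivity
  obtain ⟨N2, hN2⟩ := ((hs.tendsto (ε / 4) (by positivity)).eventually_lt_const hδ).exists_forall_of_atTop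
  refine ⟨max k N2, fun n hn => ?_⟩
  rw [Real.dist_eq, sub_zero, abs_of_nonneg (simpleInt_nonneg _ fun _ => abs_nonneg _)]
  have h1 := hN (n, k) ⟨(le_max_left N N').trans ((le_max_left _ _).trans hn), le_max_right N N'⟩
  have h2 := hN2 n ((le_max_right _ _).trans hn)
  have h3 := simpleInt_abs_le h𝒜 hm (hs.simple n)
    ((hs.simple n).map₂ h𝒜 (hs.simple k) fun x y => |x - y|) (fun ω => abs_nonneg _)
    (c := ε / 4) (C := M) (by positivity) fun ω => by
      have := abs_sub_abs_le_abs_sub (s n ω) (s k ω)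
      linarith [hM ω]
  have h4 : (m {ω | ε / 4 < |s n ω|} : ℝ) ≤ outer m {ω | ε / 4 < |s n ω - g ω|} :=
    le_outer h𝒜 ((hs.simple n).preimage_mem h𝒜 {x | ε / 4 < |x|}) fun ω h => by simpa [hg] using h
  have h5 : M * (m {ω | ε / 4 < |s n ω|} : ℝ) ≤ M * (ε / (4 * (M + 1))) := by
    gcongr; linarith
  have h6 : M * (ε / (4 * (M + 1))) ≤ ε / 4 := by
    rw [mul_div_assoc', div_le_div_iff₀ (by positivity) (by positivity)]
    nlinarith
  dsimp only at h1
  linarith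

theorem IsDetermining.tendsto_simpleInt_abs_sub (h𝒜 : IsSetAlgebra 𝒜) (hm : m univ = 1)
    {s t : ℕ → Ω → ℝ} {g : Ω → ℝ} (hs : IsDetermining m s g) (ht : IsDetermining m t g) :
    Tendsto (fun n => simpleInt m fun ω => |s n ω - t n ω|) atTop (𝓝 0) := by
  simpa using (hs.abs_sub h𝒜 ht).tendsto_simpleInt_abs_zero h𝒜 hm (by simp)

theorem IsDetermining.exists_tendsto (h𝒜 : IsSetAlgebra 𝒜) {s : ℕ → Ω → ℝ} {g : Ω → ℝ}
    (hs : IsDetermining m s g) : ∃ x, Tendsto (fun n => simpleInt m (s n)) atTop (𝓝 x) := by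
  refine cauchySeq_tendsto_of_complete (cauchySeq_iff_tendsto_dist_atTop_0.2 ?_)
  refine squeeze_zero (fun _ => dist_nonneg) (fun p => ?_) hs.cauchy
  exact abs_simpleInt_sub_le h𝒜 (hs.simple _) (hs.simple _)

/-- The integral of `g ∈ L¹(m)`. -/
noncomputable def integ (m : AddContent ℝ≥0 𝒜) (g : Ω → ℝ) : ℝ :=
  Classical.epsilon (HasIntegral m g)

/-- The integral is well defined: for two sequences determining g, |s_n - t_n| determines 0, so the
value picked by `epsilon` is the limit along each of them. -/
theorem IsDetermining.tendsto_integ (h𝒜 : IsSetAlgebra 𝒜) (hm : m univ = 1) {s : ℕ → Ω → ℝ}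
    {g : Ω → ℝ} (hs : IsDetermining m s g) :
    Tendsto (fun n => simpleInt m (s n)) atTop (𝓝 (integ m g)) := by
  obtain ⟨x, hx⟩ := hs.exists_tendsto h𝒜
  obtain ⟨t, ht, h⟩ : HasIntegral m g (integ m g) := Classical.epsilon_spec ⟨x, s, hs, hx⟩
  have h0 : Tendsto (fun n => simpleInt m (s n) - simpleInt m (t n)) atTop (𝓝 0) := by
    refine squeeze_zero_norm (fun n => ?_) (hs.tendsto_simpleInt_abs_sub h𝒜 hm ht)
    exact abs_simpleInt_sub_le h𝒜 (hs.simple _) (ht.simple _)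
  simpa using h0.add h

theorem integ_simple (h𝒜 : IsSetAlgebra 𝒜) (hm : m univ = 1) {s : Ω → ℝ} (hs : IsSimple 𝒜 s) :
    integ m s = simpleInt m s :=
  tendsto_nhds_unique ((hs.isDetermining h𝒜 hm).tendsto_integ h𝒜 hm) tendsto_const_nhds

theorem integ_linear (h𝒜 : IsSetAlgebra 𝒜) (hm : m univ = 1) {f g : Ω → ℝ} (hf : IsL1 m f)
    (hg : IsL1 m g) (x y : ℝ) :
    integ m (fun ω => x * f ω + y * g ω) = x * integ m f + y * integ m g := by
  obtain ⟨s, hs⟩ := hf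
  obtain ⟨t, ht⟩ := hg
  refine tendsto_nhds_unique ((hs.linear h𝒜 ht x y).tendsto_integ h𝒜 hm) ?_
  simp only [simpleInt_linear h𝒜 (hs.simple _) (ht.simple _)]
  exact ((hs.tendsto_integ h𝒜 hm).const_mul x).add ((ht.tendsto_integ h𝒜 hm).const_mul y)

theorem integ_nonneg (h𝒜 : IsSetAlgebra 𝒜) (hm : m univ = 1) {g : Ω → ℝ} (hg : IsL1 m g)
    (h : ∀ ω, 0 ≤ g ω) : 0 ≤ integ m g := by
  obtain ⟨s, hs⟩ := hg
  have := (hs.abs h𝒜).tendsto_integ h𝒜 hm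
  simp only [abs_of_nonneg (h _)] at this
  exact ge_of_tendsto' this fun n => simpleInt_nonneg _ fun _ => abs_nonneg _

/-- For fixed n the sequence k ↦ |s_n - s_k| determines |s_n - g|, so the integral is a limit of
quantities controlled by the Cauchy condition. -/
theorem IsDetermining.tendsto_integ_abs_sub (h𝒜 : IsSetAlgebra 𝒜) (hm : m univ = 1)
    {s : ℕ → Ω → ℝ} {g : Ω → ℝ} (hs : IsDetermining m s g) :
    Tendsto (fun n => integ m fun ω => |s n ω - g ω|) atTop (𝓝 0) := by
  rw [Metric.tendsto_atTop]
  intro ε hε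
  obtain ⟨⟨N, N'⟩, hN⟩ := (hs.cauchy.eventually_lt_const (half_pos hε)).exists_forall_of_atTop
  refine ⟨N, fun n hn => ?_⟩
  have hd := ((hs.simple n).isDetermining h𝒜 hm).abs_sub h𝒜 hs
  rw [Real.dist_eq, sub_zero, abs_of_nonneg (integ_nonneg h𝒜 hm ⟨_, hd⟩ fun _ => abs_nonneg _)]
  refine (le_of_tendsto (hd.tendsto_integ h𝒜 hm) ?_).trans_lt (half_lt_self hε)
  filter_upwards [eventually_ge_atTop N'] with k hk
  exact (hN (n, k) ⟨hn, hk⟩).le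

/-- A bounded sequence of simple functions which converges in `m`-measure is determining. -/
theorem isDetermining_of_bounded (h𝒜 : IsSetAlgebra 𝒜) (hm : m univ = 1) {s : ℕ → Ω → ℝ}
    {g : Ω → ℝ} (hs : ∀ n, IsSimple 𝒜 (s n)) (hg : TendstoInM m s g) {C : ℝ}
    (hC : ∀ n ω, |s n ω| ≤ C) : IsDetermining m s g := by
  refine ⟨hs, hg, ?_⟩
  have h2C : ∀ i j ω, |s i ω - s j ω| ≤ 2 * C := fun i j ω => by
    linarith [hC i ω, hC j ω, abs_sub (s i ω) (s j ω)]
  -- Split at level c; where |s_i - s_j| > c, one of s_i, s_j is farther than c/2 from g.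
  have key : ∀ c > 0, ∀ p : ℕ × ℕ, simpleInt m (fun ω => |s p.1 ω - s p.2 ω|) ≤
      c + |2 * C| * (outer m {ω | c / 2 < |s p.1 ω - g ω|} +
        outer m {ω | c / 2 < |s p.2 ω - g ω|}) := by
    intro c hc p
    have h1 := simpleInt_abs_le h𝒜 hm ((hs p.1).map₂ h𝒜 (hs p.2) fun x y => x - y)
      (isSimple_const h𝒜 0) (fun _ => le_rfl) (C := |2 * C|) hc.le
      fun ω => by simpa using (h2C p.1 p.2 ω).trans (le_abs_self _)
    rw [simpleInt_const h𝒜 hm, add_zero] at h1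
    refine h1.trans ?_
    gcongr
    refine (le_outer h𝒜 (((hs p.1).map₂ h𝒜 (hs p.2) fun x y => x - y).preimage_mem h𝒜
      {x | c < |x|}) Subset.rfl).trans (outer_le_add h𝒜 m fun ω hω => ?_)
    by_contra hn
    simp only [mem_union, mem_ofPred_eq, not_or, not_lt] at hn hω
    have := abs_sub_le (s p.1 ω) (g ω) (s p.2 ω)
    rw [abs_sub_comm (g ω)] at this
    have hω' : c < |s p.1 ω - s p.2 ω| := hω
    linarith [hn.1, hn.2]
  rw [Metric.tendsto_nhds]
  intro ε hε
  have h0 := hg (ε / 2 / 2) (by positivity)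
  have hlim := ((((h0.comp tendsto_fst).add (h0.comp tendsto_snd)).const_mul |2 * C|).const_add (ε / 2))
  rw [add_zero, mul_zero, add_zero, prod_atTop_atTop_eq] at hlim
  filter_upwards [hlim.eventually_lt_const (half_lt_self hε)] with p hp
  rw [Real.dist_eq, sub_zero, abs_of_nonneg (simpleInt_nonneg _ fun _ => abs_nonneg _)]
  exact (key _ (half_pos hε) p).trans_lt hp

/-- A bounded function which can be approximated in `m`-measure by simple functions is in `L¹(m)`. -/
theorem isL1_of_approx (h𝒜 : IsSetAlgebra 𝒜) (hm : m univ = 1) {g : Ω → ℝ} {C : ℝ}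
    (hC : ∀ ω, |g ω| ≤ C)
    (h : ∀ ε > 0, ∃ s, IsSimple 𝒜 s ∧ outer m {ω | ε < |s ω - g ω|} ≤ ε) : IsL1 m g := by
  choose! s hs hsg using h
  let e : ℕ → ℝ := fun n => 1 / (n + 1)
  have he : ∀ n, 0 < e n := fun n => Nat.one_div_pos_of_nat
  -- Clamping bounds the approximants uniformly. It fixes g and is 1-Lipschitz, so it does not
  -- worsen the approximation.
  let cl : ℝ → ℝ := fun a => max (-C) (min C a)
  have hlip : ∀ a b, |cl a - cl b| ≤ |a - b| := fun a b => by
    refine (abs_max_sub_max_le_max _ _ _ _).trans ?_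
    rw [sub_self, abs_zero]
    refine max_le (abs_nonneg _) ((abs_min_sub_min_le_max _ _ _ _).trans ?_)
    simp
  have hid : ∀ ω, cl (g ω) = g ω := fun ω => by
    have := abs_le.1 (hC ω)
    simp only [cl]
    rw [min_eq_right this.2, max_eq_right this.1]
  refine ⟨fun n ω => cl (s (e n) ω), isDetermining_of_bounded (C := |C|) h𝒜 hm
    (fun n => (hs _ (he n)).map h𝒜 cl) (fun c hc => ?_) fun n ω => ?_⟩
  · have ht : Tendsto e atTop (𝓝 0) := tendsto_one_div_add_atTop_nhds_zero_nat
    refine tendsto_of_tendsto_of_tendsto_of_le_of_le' tendsto_const_nhds ht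
      (Eventually.of_forall fun n => outer_nonneg _ _) ?_
    filter_upwards [ht.eventually_lt_const hc] with n hn
    refine (outer_mono h𝒜 fun ω hω => ?_).trans (hsg _ (he n))
    have := hlip (s (e n) ω) (g ω)
    rw [hid] at this
    simp only [mem_ofPred_eq] at hω ⊢
    linarith
  · rw [abs_le]
    exact ⟨(neg_le_neg (le_abs_self C)).trans (le_max_left _ _),
      max_le (neg_le_abs C) ((min_le_left _ _).trans (le_abs_self C))⟩

theorem IsL1.exists_approx {g : Ω → ℝ} (hg : IsL1 m g) {δ ε : ℝ} (hδ : 0 < δ) (hε : 0 < ε) :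
    ∃ s, IsSimple 𝒜 s ∧ outer m {ω | δ < |s ω - g ω|} < ε := by
  obtain ⟨s, hs⟩ := hg
  obtain ⟨n, hn⟩ := ((hs.tendsto δ hδ).eventually_lt_const hε).exists
  exact ⟨s n, hs.simple n, hn⟩

/-- This gives the uniform closedness of Λ_b that the Stone–Weierstrass argument requires. -/
theorem isL1_of_uniform_approx (h𝒜 : IsSetAlgebra 𝒜) (hm : m univ = 1) {g : Ω → ℝ} {C : ℝ}
    (hC : ∀ ω, |g ω| ≤ C) (h : ∀ ε > 0, ∃ g', IsL1 m g' ∧ ∀ ω, |g' ω - g ω| ≤ ε) : IsL1 m g := by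
  refine isL1_of_approx h𝒜 hm hC fun ε hε => ?_
  obtain ⟨g', hg', hg⟩ := h (ε / 2) (half_pos hε)
  obtain ⟨s, hs, hsg⟩ := hg'.exists_approx (half_pos hε) hε
  refine ⟨s, hs, (outer_mono h𝒜 fun ω hω => ?_).trans hsg.le⟩
  simp only [mem_ofPred_eq] at hω ⊢
  linarith [hg ω, abs_sub_le (s ω) (g' ω) (g ω)]

theorem IsDetermining.indicator (h𝒜 : IsSetAlgebra 𝒜) {s : ℕ → Ω → ℝ} {g : Ω → ℝ}
    (hs : IsDetermining m s g) {A : Set Ω} (hA : A ∈ 𝒜) :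
    IsDetermining m (fun n => A.indicator (s n)) (A.indicator g) := by
  have hle : ∀ u v : Ω → ℝ, ∀ ω, |A.indicator u ω - A.indicator v ω| ≤ |u ω - v ω| := by
    intro u v ω
    by_cases h : ω ∈ A <;> simp [h]
  refine ⟨fun n => isSimple_indicator h𝒜 hA (hs.simple n), fun c hc => ?_, ?_⟩
  · exact squeeze_zero (fun n => outer_nonneg _ _)
      (fun n => outer_mono h𝒜 fun ω hω => lt_of_lt_of_le hω (hle _ _ _)) (hs.tendsto c hc)
  · refine squeeze_zero (fun n => simpleInt_nonneg _ fun _ => abs_nonneg _) (fun n => ?_) hs.cauchy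
    exact simpleInt_mono h𝒜 ((isSimple_indicator h𝒜 hA (hs.simple n.1)).map₂ h𝒜
      (isSimple_indicator h𝒜 hA (hs.simple n.2)) fun x y => |x - y|)
      ((hs.simple _).map₂ h𝒜 (hs.simple _) fun x y => |x - y|) fun ω => hle _ _ ω

/-- Bounded continuous functions act on `L¹(m)`, and on determining sequences. -/
theorem isDetermining_comp (h𝒜 : IsSetAlgebra 𝒜) (hm : m univ = 1) {n : ℕ}
    {s : Fin n → ℕ → Ω → ℝ} {g : Fin n → Ω → ℝ} (hs : ∀ i, IsDetermining m (s i) (g i))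
    (α : BoundedContinuousFunction (Fin n → ℝ) ℝ) :
    IsDetermining m (fun k ω => α fun i => s i k ω) (fun ω => α fun i => g i ω) := by
  have houter : ∀ (F : Fin n → Set Ω), outer m (⋃ i, F i) ≤ ∑ i, outer m (F i) := by
    intro F
    have : ∀ t : Finset (Fin n), outer m (⋃ i ∈ t, F i) ≤ ∑ i ∈ t, outer m (F i) := fun t => by
      induction t using Finset.induction_on with
      | empty => simpa using outer_le m h𝒜.empty_mem Subset.rfl
      | insert i t hi ih =>
        rw [Finset.set_biUnion_insert, Finset.sum_insert hi]
        linarith [outer_le_add h𝒜 m (Subset.refl (F i ∪ ⋃ i ∈ t, F i))]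
    simpa using this Finset.univ
  refine isDetermining_of_bounded (C := ‖α‖) h𝒜 hm
    (fun k => IsSimple.pi h𝒜 (fun i => (hs i).simple k) α) (fun c hc => ?_)
    fun k ω => α.norm_coe_le_norm _
  rw [Metric.tendsto_nhds]
  intro ε hε
  -- There will be 2n exceptional sets, each of outer measure below this number; n + 1 instead of n
  -- keeps the case n = 0 harmless.
  have hη : 0 < ε / (2 * (n + 1)) := by positivity
  have h1 : ∀ i, ∃ N, outer m {ω | 1 < |s i N ω - g i ω|} < ε / (2 * (n + 1)) := fun i =>
    (((hs i).tendsto 1 one_pos).eventually_lt_const hη).exists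
  choose N hN using h1
  choose M hM0 hM using fun i => ((hs i).simple (N i)).exists_bound
  -- α is uniformly continuous only on compact sets. Off small sets g_i is within 1 of a simple
  -- function bounded by M_i, and s_i k is within 1 of g_i, so all values lie in the cube [-R, R]^n.
  let R : ℝ := ∑ i, (M i + 2)
  have hR : ∀ i, M i + 2 ≤ R := fun i =>
    Finset.single_le_sum (f := fun i => M i + 2) (fun j _ => by linarith [hM0 j])
      (Finset.mem_univ i)
  obtain ⟨δ, hδ, huc⟩ := Metric.uniformContinuousOn_iff.1
    ((isCompact_univ_pi fun _ : Fin n => isCompact_Icc (a := -R) (b := R)).uniformContinuousOn_of_continuous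
      α.continuous.continuousOn) c hc
  let d := min (δ / 2) 1
  have hd : 0 < d := by positivity
  have h2 : ∀ᶠ k in atTop, ∀ i, outer m {ω | d < |s i k ω - g i ω|} < ε / (2 * (n + 1)) :=
    eventually_all.2 fun i => ((hs i).tendsto d hd).eventually_lt_const hη
  filter_upwards [h2] with k hk
  rw [Real.dist_eq, sub_zero, abs_of_nonneg (outer_nonneg _ _)]
  have hsub : {ω | c < |(α fun i => s i k ω) - α fun i => g i ω|} ⊆
      (⋃ i, {ω | 1 < |s i (N i) ω - g i ω|}) ∪ ⋃ i, {ω | d < |s i k ω - g i ω|} := by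
    intro ω hω
    by_contra hn
    simp only [mem_union, mem_iUnion, mem_ofPred_eq, not_or, not_exists, not_lt] at hn hω
    have hg : ∀ i, |g i ω| ≤ M i + 1 := fun i => by
      have := abs_sub_abs_le_abs_sub (g i ω) (s i (N i) ω)
      rw [abs_sub_comm] at this
      linarith [hn.1 i, hM i ω]
    have hs' : ∀ i, |s i k ω| ≤ M i + 2 := fun i => by
      have := abs_sub_abs_le_abs_sub (s i k ω) (g i ω)
      linarith [hn.2 i, hg i, min_le_right (δ / 2) 1]
    have := huc (fun i => s i k ω) (by
      rw [mem_univ_pi]; exact fun i => abs_le.1 ((hs' i).trans (hR i)))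
      (fun i => g i ω) (by
      rw [mem_univ_pi]; exact fun i => abs_le.1 ((hg i).trans (by linarith [hR i])))
      ((dist_pi_lt_iff hδ).2 fun i => by
        rw [Real.dist_eq]
        linarith [hn.2 i, min_le_left (δ / 2) 1])
    rw [Real.dist_eq] at this
    linarith
  refine (outer_le_add h𝒜 m hsub).trans_lt ?_
  have h3 : ∑ i : Fin n, outer m {ω | 1 < |s i (N i) ω - g i ω|} ≤ ∑ i : Fin n, ε / (2 * (n + 1)) :=
    Finset.sum_le_sum fun i _ => (hN i).le
  have h4 : ∑ i : Fin n, outer m {ω | d < |s i k ω - g i ω|} ≤ ∑ i : Fin n, ε / (2 * (n + 1)) :=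
    Finset.sum_le_sum fun i _ => (hk i).le
  rw [Finset.sum_const, Finset.card_univ, Fintype.card_fin, nsmul_eq_mul] at h3 h4
  have h5 : n * (ε / (2 * (n + 1))) + n * (ε / (2 * (n + 1))) < ε := by
    have : n * (ε / (2 * (n + 1))) + n * (ε / (2 * (n + 1))) = ε * (n / (n + 1)) := by
      field_simp; ring
    rw [this]
    have : (n : ℝ) / (n + 1) < 1 := by rw [div_lt_one (by positivity)]; linarith
    nlinarith
  linarith [houter fun i => {ω | 1 < |s i (N i) ω - g i ω|},
    houter fun i => {ω | d < |s i k ω - g i ω|}]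

/-- Chebyshev's inequality. -/
theorem mul_outer_le_integ (h𝒜 : IsSetAlgebra 𝒜) (hm : m univ = 1) {g : Ω → ℝ} (hg : IsL1 m g)
    {c d : ℝ} (hc : 0 ≤ c) (hcd : c < d) :
    c * outer m {ω | d < |g ω|} ≤ integ m fun ω => |g ω| := by
  obtain ⟨s, hs⟩ := hg
  -- The gap d - c absorbs the error of replacing g by s_n, so that Chebyshev can be applied to s_n
  -- at level c.
  have h1 := ((hs.tendsto (d - c) (by linarith)).const_mul c).add ((hs.abs h𝒜).tendsto_integ h𝒜 hm)
  rw [mul_zero, zero_add] at h1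
  refine ge_of_tendsto' h1 fun n => ?_
  have h2 : outer m {ω | d < |g ω|} ≤
      outer m {ω | d - c < |s n ω - g ω|} + outer m {ω | c < |s n ω|} := by
    refine outer_le_add h𝒜 m fun ω hω => ?_
    by_contra hn
    simp only [mem_union, mem_ofPred_eq, not_or, not_lt] at hn hω
    have := abs_sub_abs_le_abs_sub (g ω) (s n ω)
    rw [abs_sub_comm] at this
    linarith [hn.1, hn.2]
  have h3 := mul_measure_le_simpleInt (m := m) h𝒜 (hs.simple n) c
  have h4 := outer_le m ((hs.simple n).preimage_mem h𝒜 {x | c < |x|}) Subset.rfl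
  have h5 := mul_le_mul_of_nonneg_left (h2.trans (add_le_add_right h4 _)) hc
  rw [mul_add] at h5
  exact h5.trans (add_le_add_right h3 _)

/-- If g is null, the constant sequence 0 determines it; the converse is Chebyshev's inequality. -/
theorem nullOn_univ_iff (h𝒜 : IsSetAlgebra 𝒜) (hm : m univ = 1) {g : Ω → ℝ} (hg : IsL1 m g) :
    NullOn m g univ ↔ (integ m fun ω => |g ω|) = 0 := by
  constructor
  · intro h
    have h0 : simpleInt m (fun _ : Ω => (0 : ℝ)) = 0 := simpleInt_const h𝒜 hm 0
    have hd : IsDetermining m (fun _ _ => 0) g := by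
      refine ⟨fun _ => isSimple_const h𝒜 0, fun c hc => ?_, by simp [h0]⟩
      have := h c hc
      simp only [univ_inter] at this
      simp [this]
    refine tendsto_nhds_unique ((hd.abs h𝒜).tendsto_integ h𝒜 hm) ?_
    simp [h0]
  · intro h c hc
    have := mul_outer_le_integ h𝒜 hm hg (c := c / 2) (d := c) (by positivity) (by linarith)
    rw [h] at this
    rw [univ_inter]
    nlinarith [outer_nonneg m {ω | c < |g ω|}]

/-- A squeeze B ⊆ A ⊆ D makes 1_B close to 1_A in measure. Conversely, if a simple s is within 1/4
of 1_A off a small D, then {s > 1/2} \ D ⊆ A ⊆ {s > 1/2} ∪ D. -/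
theorem mem_completion_iff_isL1_indicator (h𝒜 : IsSetAlgebra 𝒜) (hm : m univ = 1) {A : Set Ω} :
    A ∈ completion h𝒜 m ↔ IsL1 m (A.indicator fun _ => 1) := by
  constructor
  · intro hA
    refine isL1_of_approx (C := 1) h𝒜 hm (fun ω => ?_) fun ε hε => ?_
    · by_cases h : ω ∈ A <;> simp [h]
    · obtain ⟨B, hB, D, hD, hBA, hAD, hlt⟩ := hA ε hε
      refine ⟨_, isSimple_indicator h𝒜 hB (isSimple_const h𝒜 1),
        (outer_le m (h𝒜.sdiff_mem hD hB) fun ω hω => ?_).trans hlt.le⟩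
      by_cases h1 : ω ∈ B
      · simp [h1, hBA h1, not_lt.2 hε.le] at hω
      · by_cases h2 : ω ∈ A
        · exact ⟨hAD h2, h1⟩
        · simp [h1, h2, not_lt.2 hε.le] at hω
  · intro h ε hε
    obtain ⟨s, hs, hlt⟩ := h.exists_approx (δ := 1 / 4) (by norm_num) hε
    obtain ⟨D, hD, hsub, hDε⟩ := exists_cover h𝒜 hlt
    have hP : s ⁻¹' {x | 1 / 2 < x} ∈ 𝒜 := hs.preimage_mem h𝒜 _
    refine ⟨_, h𝒜.sdiff_mem hP hD, _, h𝒜.union_mem hP hD, ?_, ?_, ?_⟩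
    · rintro ω ⟨h1, h2⟩
      by_contra h3
      have := fun h => h2 (hsub h)
      simp only [mem_ofPred_eq, h3, not_false_eq_true, indicator_of_notMem, mem_preimage] at this h1
      exact this (by linarith [le_abs_self (s ω - 0)])
    · intro ω hω
      by_contra h3
      have := fun h => h3 (Or.inr (hsub h))
      simp only [mem_ofPred_eq, hω, indicator_of_mem] at this
      have h4 : ¬ 1 / 2 < s ω := fun h => h3 (Or.inl h)
      exact this (by linarith [neg_abs_le (s ω - 1)])
    · refine (measure_mono h𝒜 (h𝒜.sdiff_mem (h𝒜.union_mem hP hD) (h𝒜.sdiff_mem hP hD)) hD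
        fun ω hω => ?_).trans_lt hDε
      simp only [Set.mem_sdiff, mem_union] at hω
      tauto

/-- A superlevel set `{g > c}` of `g ∈ L¹(m)` belongs to the completion as soon as the level `c`
carries no mass. -/
theorem superlevel_mem_completion (h𝒜 : IsSetAlgebra 𝒜) {g : Ω → ℝ} (hg : IsL1 m g) {c : ℝ}
    (hc : ∀ ε > 0, ∃ δ > 0, outer m {ω | |g ω - c| ≤ δ} < ε) :
    {ω | c < g ω} ∈ completion h𝒜 m := by
  intro ε hε
  obtain ⟨δ, hδ, hlt⟩ := hc (ε / 2) (half_pos hε)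
  obtain ⟨s, hs, hlt'⟩ := hg.exists_approx (half_pos hδ) (half_pos hε)
  obtain ⟨D, hD, hsub, hDε⟩ := exists_cover h𝒜 hlt'
  obtain ⟨F, hF, hsubF, hFε⟩ := exists_cover h𝒜 hlt
  have hclose : ∀ ω, ω ∉ D → |s ω - g ω| ≤ δ / 2 := fun ω h => by
    by_contra h'
    exact h (hsub (not_le.1 h'))
  have hfar : ∀ ω, ω ∉ F → δ < |g ω - c| := fun ω h => by
    by_contra h'
    exact h (hsubF (not_lt.1 h'))
  have hP : s ⁻¹' {x | c + δ / 2 < x} ∈ 𝒜 := hs.preimage_mem h𝒜 _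
  have hQ : s ⁻¹' {x | c - δ / 2 < x} ∈ 𝒜 := hs.preimage_mem h𝒜 _
  -- Off D, s is within δ/2 of g; off F, g is farther than δ from c. The outer and inner sets differ
  -- only inside D ∪ F, since c - δ/2 < s ≤ c + δ/2 off D would force |g - c| ≤ δ.
  refine ⟨_, h𝒜.sdiff_mem hP hD, _, h𝒜.union_mem hQ hD, ?_, ?_, ?_⟩
  · rintro ω ⟨h1, h2⟩
    have := abs_le.1 (hclose ω h2)
    simp only [mem_preimage, mem_ofPred_eq] at h1 ⊢
    linarith
  · intro ω hω
    by_cases h2 : ω ∈ D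
    · exact Or.inr h2
    · left
      have := abs_le.1 (hclose ω h2)
      simp only [mem_preimage, mem_ofPred_eq] at hω ⊢
      linarith
  · have h3 : (m (D ∪ F) : ℝ) ≤ m D + m F := by
      exact_mod_cast addContent_union_le (m := m) h𝒜.isSetRing hD hF
    refine (measure_mono h𝒜 (h𝒜.sdiff_mem (h𝒜.union_mem hQ hD) (h𝒜.sdiff_mem hP hD))
      (h𝒜.union_mem hD hF) fun ω hω => ?_).trans_lt (by linarith)
    by_contra hn
    simp only [mem_union, not_or] at hn
    simp only [mem_union, Set.mem_sdiff, mem_preimage, mem_ofPred_eq, not_and, not_not] at hω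
    have h4 := abs_le.1 (hclose ω hn.1)
    have h5 := hfar ω hn.2
    have h6 : c - δ / 2 < s ω := by tauto
    have h7 : s ω ≤ c + δ / 2 := by
      by_contra h
      exact hn.1 (hω.2 (not_le.1 h))
    exact absurd h5 (not_lt.2 (abs_le.2 ⟨by linarith, by linarith⟩))

end Integral
end FinAdd

namespace FinAdd

/-! ### The compactification attached to an algebra of bounded functions -/

section Spec

variable {P : Type*} {B : Subalgebra ℝ (P → ℝ)}

/-- The closure of the image of `P` in the product `ℝ^B` under evaluation. -/
def Spec (B : Subalgebra ℝ (P → ℝ)) : Type _ :=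
  closure (range fun (p : P) (H : B) => (H : P → ℝ) p)

instance : TopologicalSpace (Spec B) :=
  inferInstanceAs (TopologicalSpace (closure (range fun (p : P) (H : B) => (H : P → ℝ) p)))

instance : T2Space (Spec B) :=
  inferInstanceAs (T2Space (closure (range fun (p : P) (H : B) => (H : P → ℝ) p)))

instance : MeasurableSpace (Spec B) := borel _

instance : BorelSpace (Spec B) := ⟨rfl⟩

theorem compactSpace_spec (hB : ∀ H ∈ B, ∃ C : ℝ, ∀ p, |H p| ≤ C) : CompactSpace (Spec B) := by
  choose! C hC using hB
  refine isCompact_iff_compactSpace.1 (IsCompact.of_isClosed_subset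
    (isCompact_univ_pi fun H : B => isCompact_Icc (a := -C H) (b := C H)) isClosed_closure
    (closure_minimal ?_ (isClosed_set_pi fun H _ => isClosed_Icc)))
  rintro _ ⟨p, rfl⟩ H -
  exact abs_le.1 (hC H H.2 p)

/-- The canonical map `P → Spec B`. -/
def toSpec (B : Subalgebra ℝ (P → ℝ)) (p : P) : Spec B :=
  ⟨fun H => (H : P → ℝ) p, subset_closure ⟨p, rfl⟩⟩

theorem denseRange_toSpec : DenseRange (toSpec B) := by
  intro s
  refine closure_subtype.2 (closure_mono ?_ s.2)
  rintro _ ⟨p, rfl⟩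
  exact ⟨toSpec B p, ⟨p, rfl⟩, rfl⟩

/-- The extension of the members of `B` to continuous functions on `Spec B`. -/
def gel (B : Subalgebra ℝ (P → ℝ)) : B →ₐ[ℝ] C(Spec B, ℝ) where
  toFun H := ⟨fun s => s.1 H, (continuous_apply H).comp continuous_subtype_val⟩
  map_one' := ContinuousMap.coe_injective <| denseRange_toSpec.equalizer
    (by fun_prop) (by fun_prop) <| by ext p; rfl
  map_mul' H G := ContinuousMap.coe_injective <| denseRange_toSpec.equalizer
    (by fun_prop) (by fun_prop) <| by ext p; rfl
  map_zero' := ContinuousMap.coe_injective <| denseRange_toSpec.equalizer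
    (by fun_prop) (by fun_prop) <| by ext p; rfl
  map_add' H G := ContinuousMap.coe_injective <| denseRange_toSpec.equalizer
    (by fun_prop) (by fun_prop) <| by ext p; rfl
  commutes' c := ContinuousMap.coe_injective <| denseRange_toSpec.equalizer
    (by fun_prop) (by fun_prop) <| by ext p; rfl

/-- A closed relation holding on the dense image of P holds on the whole space. All transfers from P
to `Spec B` beyond the algebra operations (order, max, indicators) rest on this density. -/
theorem gel_mem_of_isClosed {ι : Type*} (H : ι → B) {Q : Set (ι → ℝ)} (hQ : IsClosed Q)
    (h : ∀ p, (fun i => (H i : P → ℝ) p) ∈ Q) (s : Spec B) : (fun i => gel B (H i) s) ∈ Q :=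
  denseRange_toSpec.induction_on (p := fun s => (fun i => gel B (H i) s) ∈ Q) s
    (hQ.preimage (continuous_pi fun i => (gel B (H i)).continuous)) h

theorem gel_pi {ι : Type*} (H : ι → B) (G : B) {α : (ι → ℝ) → ℝ} (hα : Continuous α)
    (h : ∀ p, (G : P → ℝ) p = α fun i => (H i : P → ℝ) p) (s : Spec B) :
    gel B G s = α fun i => gel B (H i) s :=
  denseRange_toSpec.induction_on (p := fun s => gel B G s = α fun i => gel B (H i) s) s
    (isClosed_eq (gel B G).continuous
      (hα.comp (continuous_pi fun i => (gel B (H i)).continuous))) h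

theorem gel_map (H G : B) {φ : ℝ → ℝ} (hφ : Continuous φ)
    (h : ∀ p, (G : P → ℝ) p = φ ((H : P → ℝ) p)) (s : Spec B) : gel B G s = φ (gel B H s) :=
  gel_pi (fun _ : Unit => H) G (α := fun v => φ (v ())) (by fun_prop) h s

theorem gel_map₂ (H K G : B) {φ : ℝ → ℝ → ℝ} (hφ : Continuous fun x : ℝ × ℝ => φ x.1 x.2)
    (h : ∀ p, (G : P → ℝ) p = φ ((H : P → ℝ) p) ((K : P → ℝ) p)) (s : Spec B) :
    gel B G s = φ (gel B H s) (gel B K s) :=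
  gel_pi (fun i : Bool => cond i H K) G (α := fun v => φ (v true) (v false))
    (hφ.comp (f := fun v : Bool → ℝ => (v true, v false)) (by fun_prop)) h s

theorem gel_nonneg_iff (H : B) : (∀ s, 0 ≤ gel B H s) ↔ ∀ p, 0 ≤ (H : P → ℝ) p :=
  ⟨fun h p => h (toSpec B p), fun h s =>
    gel_mem_of_isClosed (fun _ : Unit => H) (Q := {v | 0 ≤ v ()})
      (isClosed_le continuous_const (continuous_apply ())) h s⟩

/-- Distinct points of `Spec B` differ in some coordinate H, so the range separates points and is
dense by Stone–Weierstrass. Given φ, its restriction to P is a uniform limit of members of B, hence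
lies in B, and its extension is φ by density of P. -/
theorem gel_bijective (hB : ∀ H ∈ B, ∃ C : ℝ, ∀ p, |H p| ≤ C)
    (hcl : ∀ H : P → ℝ, (∀ ε > 0, ∃ G ∈ B, ∀ p, |G p - H p| ≤ ε) → H ∈ B) :
    Function.Bijective (gel B) := by
  have := compactSpace_spec hB
  refine ⟨fun H G h => Subtype.ext (funext fun p => DFunLike.congr_fun h (toSpec B p)),
    fun φ => ?_⟩
  have hsep : (gel B).range.SeparatesPoints := by
    intro s t hst
    by_contra hn
    refine hst (Subtype.ext (funext fun H => ?_))
    by_contra h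
    exact hn ⟨_, ⟨gel B H, ⟨H, rfl⟩, rfl⟩, h⟩
  have htop := ContinuousMap.subalgebra_topologicalClosure_eq_top_of_separatesPoints _ hsep
  have hφ : φ ∈ closure ((gel B).range : Set C(Spec B, ℝ)) := by
    rw [← Subalgebra.topologicalClosure_coe, htop]
    trivial
  let H : P → ℝ := fun p => φ (toSpec B p)
  have hH : H ∈ B := hcl H fun ε hε => by
    obtain ⟨_, ⟨G, rfl⟩, hG⟩ := Metric.mem_closure_iff.1 hφ ε hε
    refine ⟨G, G.2, fun p => ?_⟩
    rw [dist_comm] at hG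
    exact (ContinuousMap.dist_apply_le_dist (f := gel B G) (g := φ) (toSpec B p)).trans hG.le
  exact ⟨⟨H, hH⟩, ContinuousMap.coe_injective <| denseRange_toSpec.equalizer
    (by fun_prop) (by fun_prop) <| by ext p; rfl⟩

theorem gel_eq_zero_or_one {H : B} (h : ∀ p, (H : P → ℝ) p = 0 ∨ (H : P → ℝ) p = 1) (s : Spec B) :
    gel B H s = 0 ∨ gel B H s = 1 :=
  gel_mem_of_isClosed (fun _ : Unit => H) (Q := {v | v () = 0 ∨ v () = 1})
    ((isClosed_eq (continuous_apply ()) continuous_const).union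
      (isClosed_eq (continuous_apply ()) continuous_const)) h s

theorem isClopen_gel_eq_one {H : B} (h : ∀ p, (H : P → ℝ) p = 0 ∨ (H : P → ℝ) p = 1) :
    IsClopen {s | gel B H s = 1} := by
  refine ⟨isClosed_eq (gel B H).continuous continuous_const, ?_⟩
  have : {s | gel B H s = 1} = {s | gel B H s = 0}ᶜ := by
    ext s
    rcases gel_eq_zero_or_one h s with h | h <;> simp [h]
  rw [this]
  exact (isClosed_eq (gel B H).continuous continuous_const).isOpen_compl

end Spec

/-! ### The representing measure -/

section Measure

variable {Ω X : Type*} {𝒜 : Set (Set Ω)} {h𝒜 : IsSetAlgebra 𝒜} {m : AddContent ℝ≥0 𝒜} {f : Ω → X}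

instance : CompactSpace (Spec (LamB h𝒜 m f)) := compactSpace_spec fun _ hH => hH.2

theorem gel_lamB_bijective (hm : m univ = 1) : Function.Bijective (gel (LamB h𝒜 m f)) := by
  refine gel_bijective (fun _ hH => hH.2) fun H h => ?_
  obtain ⟨G, hG, hGH⟩ := h 1 one_pos
  obtain ⟨C, hC⟩ := hG.2
  have hb : ∀ p, |H p| ≤ C + 1 := fun p => by
    have := abs_sub_abs_le_abs_sub (H p) (G p)
    rw [abs_sub_comm] at this
    linarith [hC p, hGH p]
  refine ⟨isL1_of_uniform_approx h𝒜 hm (C := C + 1) (fun ω => hb _) fun ε hε => ?_, C + 1, hb⟩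
  obtain ⟨G, hG, hGH⟩ := h ε hε
  exact ⟨_, hG.1, fun ω => hGH _⟩

/-- The algebra isomorphism of `Λ_b(m, f)` with `C(S)`. -/
noncomputable def gelEquiv (h𝒜 : IsSetAlgebra 𝒜) (hm : m univ = 1) (f : Ω → X) :
    LamB h𝒜 m f ≃ₐ[ℝ] C(Spec (LamB h𝒜 m f), ℝ) :=
  AlgEquiv.ofBijective (gel _) (gel_lamB_bijective hm)

theorem gel_gelEquiv_symm (hm : m univ = 1) (φ : C(Spec (LamB h𝒜 m f), ℝ)) :
    gel _ ((gelEquiv h𝒜 hm f).symm φ) = φ :=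
  (gelEquiv h𝒜 hm f).apply_symm_apply φ

theorem integ_along_linear (hm : m univ = 1) (H G : LamB h𝒜 m f) (x y : ℝ) :
    integ m (along f (x • H + y • G : LamB h𝒜 m f)) = x * integ m (along f H) + y * integ m (along f G) :=
  integ_linear h𝒜 hm H.2.1 G.2.1 x y

/-- Riesz representation of φ ↦ ∫ H(f) dm, where H ∈ Λ_b corresponds to φ. On a compact space every
continuous function has compact support, and H = 1 shows that the total mass is 1. -/
theorem exists_representing_measure (h𝒜 : IsSetAlgebra 𝒜) (hm : m univ = 1) (f : Ω → X) :
    ∃ μ : Measure (Spec (LamB h𝒜 m f)), IsProbabilityMeasure μ ∧ μ.Regular ∧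
      ∀ H : LamB h𝒜 m f, ∫ s, gel _ H s ∂μ = integ m (along f H) := by
  let e := (gelEquiv h𝒜 hm f).symm
  let L : CompactlySupportedContinuousMap (Spec (LamB h𝒜 m f)) ℝ →ₗ[ℝ] ℝ :=
    { toFun := fun φ => integ m (along f (e φ.toContinuousMap))
      map_add' := fun φ ψ => by
        have : e (φ + ψ).toContinuousMap =
            (1 : ℝ) • e φ.toContinuousMap + (1 : ℝ) • e ψ.toContinuousMap := by
          rw [one_smul, one_smul, ← map_add]; rfl
        rw [this, integ_along_linear hm, one_mul, one_mul]
      map_smul' := fun c φ => by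
        have : e (c • φ).toContinuousMap = c • e φ.toContinuousMap + (0 : ℝ) • e φ.toContinuousMap := by
          rw [zero_smul, add_zero, ← map_smul]; rfl
        rw [this, integ_along_linear hm, zero_mul, add_zero]; rfl }
  let Λ := PositiveLinearMap.mk₀ L fun φ hφ =>
    integ_nonneg h𝒜 hm (e φ.toContinuousMap).2.1 fun ω =>
      (gel_nonneg_iff (e φ.toContinuousMap)).1
        (fun s => by rw [gel_gelEquiv_symm hm]; exact hφ s) _
  have hint : ∀ H : LamB h𝒜 m f, ∫ s, gel _ H s ∂(RealRMK.rieszMeasure Λ) = integ m (along f H) := by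
    intro H
    have h := RealRMK.integral_rieszMeasure Λ
      (CompactlySupportedContinuousMap.continuousMapEquiv (gel _ H))
    have h2 : Λ (CompactlySupportedContinuousMap.continuousMapEquiv (gel _ H)) =
        integ m (along f (e (gel _ H))) := rfl
    rw [h2] at h
    have h3 : e (gel _ H) = H := (gelEquiv h𝒜 hm f).symm_apply_apply H
    rw [h3] at h
    exact h
  refine ⟨RealRMK.rieszMeasure Λ, ?_, inferInstance, hint⟩
  have h1 := hint 1
  have h2 : integ m (along f (1 : LamB h𝒜 m f)) = 1 :=
    (integ_simple h𝒜 hm (isSimple_const h𝒜 1)).trans (simpleInt_const h𝒜 hm 1)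
  rw [h2, map_one] at h1
  simp only [ContinuousMap.one_apply, integral_const, smul_eq_mul, mul_one] at h1
  refine ⟨?_⟩
  rwa [Measure.real, ENNReal.toReal_eq_one_iff] at h1

/-- The element of `Λ_b(m, f)` given by a simple function on `Ω`. -/
def IsSimple.lift (h𝒜 : IsSetAlgebra 𝒜) (hm : m univ = 1) (f : Ω → X) {s : Ω → ℝ}
    (hs : IsSimple 𝒜 s) : LamB h𝒜 m f :=
  ⟨fun p => s p.1, ⟨_, hs.isDetermining h𝒜 hm⟩, hs.exists_bound.imp fun _ h p => h.2 p.1⟩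

/-! ### The isometry of Λ_b into L¹ and its extension to Λ. -/

variable (μ : Measure (Spec (LamB h𝒜 m f))) [IsProbabilityMeasure μ]

/-- The class in `L¹(μ)` of the continuous function corresponding to an element of `Λ_b(m, f)`. -/
noncomputable def cls : LamB h𝒜 m f →ₗ[ℝ] Lp ℝ 1 μ :=
  (ContinuousMap.toLp (E := ℝ) 1 μ ℝ).toLinearMap ∘ₗ (gel (LamB h𝒜 m f)).toLinearMap

theorem coeFn_cls (H : LamB h𝒜 m f) : cls μ H =ᵐ[μ] gel _ H :=
  ContinuousMap.coeFn_toLp μ (gel _ H)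

variable {μ}

theorem norm_cls (hμ : ∀ H : LamB h𝒜 m f, ∫ s, gel _ H s ∂μ = integ m (along f H))
    (H : LamB h𝒜 m f) : ‖cls μ H‖ = integ m fun ω => |along f H ω| := by
  let G : LamB h𝒜 m f := ⟨fun p => |(H : Ω × X → ℝ) p|,
    IsL1.map₂ h𝒜 H.2.1 H.2.1 (fun a _ => |a|) 1 one_pos fun a b a' b' => by
      rw [one_mul]
      exact (abs_abs_sub_abs_le_abs_sub _ _).trans (le_add_of_nonneg_right (abs_nonneg _)),
    H.2.2.imp fun C hC p => by rw [abs_abs]; exact hC p⟩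
  have h1 : (integ m fun ω => |along f H ω|) = ∫ s, gel _ G s ∂μ := (hμ G).symm
  rw [h1, L1.norm_eq_integral_norm]
  refine integral_congr_ae ?_
  filter_upwards [coeFn_cls μ H] with s hs
  rw [hs, gel_map H G continuous_abs (fun _ => rfl), Real.norm_eq_abs]

theorem norm_cls_sub (hμ : ∀ H : LamB h𝒜 m f, ∫ s, gel _ H s ∂μ = integ m (along f H))
    (H G : LamB h𝒜 m f) : ‖cls μ H - cls μ G‖ = integ m fun ω => |along f H ω - along f G ω| := by
  rw [← map_sub, norm_cls hμ]; rfl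

/-- Classes of simple functions s, t lie at distance ∫|s - t| dm. Hence a determining sequence is
Cauchy in the complete space L¹, and sequences determining the same function have the same limit. -/
theorem exists_extension (hm : m univ = 1)
    (hμ : ∀ H : LamB h𝒜 m f, ∫ s, gel _ H s ∂μ = integ m (along f H)) :
    ∃ T : Lam h𝒜 m f →ₗ[ℝ] Lp ℝ 1 μ, ∀ (H : Lam h𝒜 m f) (s : ℕ → Ω → ℝ)
      (hs : IsDetermining m s (along f H)),
      Tendsto (fun n => cls μ ((hs.simple n).lift h𝒜 hm f)) atTop (𝓝 (T H)) := by
  have hdist : ∀ {s t : Ω → ℝ} (hs : IsSimple 𝒜 s) (ht : IsSimple 𝒜 t),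
      dist (cls μ (hs.lift h𝒜 hm f)) (cls μ (ht.lift h𝒜 hm f)) = simpleInt m fun ω => |s ω - t ω| :=
    fun hs ht => by
      rw [dist_eq_norm, norm_cls_sub hμ]
      exact integ_simple h𝒜 hm (hs.map₂ h𝒜 ht fun x y => |x - y|)
  have hlim : ∀ H : Lam h𝒜 m f, ∃ x : Lp ℝ 1 μ, ∀ (s : ℕ → Ω → ℝ)
      (hs : IsDetermining m s (along f H)),
      Tendsto (fun n => cls μ ((hs.simple n).lift h𝒜 hm f)) atTop (𝓝 x) := by
    intro H
    obtain ⟨t, ht⟩ := H.2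
    obtain ⟨x, hx⟩ : ∃ x, Tendsto (fun n => cls μ ((ht.simple n).lift h𝒜 hm f)) atTop (𝓝 x) := by
      refine cauchySeq_tendsto_of_complete (cauchySeq_iff_tendsto_dist_atTop_0.2 ?_)
      simp only [hdist]
      exact ht.cauchy
    refine ⟨x, fun s hs => ?_⟩
    refine (tendsto_iff_of_dist ?_).1 hx
    simp only [hdist]
    exact ht.tendsto_simpleInt_abs_sub h𝒜 hm hs
  choose T hT using hlim
  have hlin : ∀ (H G : Lam h𝒜 m f) (x y : ℝ), T (x • H + y • G) = x • T H + y • T G := by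
    intro H G x y
    obtain ⟨s, hs⟩ := H.2
    obtain ⟨t, ht⟩ := G.2
    refine tendsto_nhds_unique (hT (x • H + y • G) _ (hs.linear h𝒜 ht x y)) ?_
    have := ((hT H s hs).const_smul x).add ((hT G t ht).const_smul y)
    simp only [← map_smul, ← map_add] at this
    exact this
  refine ⟨⟨⟨T, fun H G => by simpa using hlin H G 1 1⟩, fun c H => by simpa using hlin H H c 0⟩, hT⟩

end Measure
end FinAdd

namespace FinAdd

section Representation

variable {Ω X : Type*} {𝒜 : Set (Set Ω)} {h𝒜 : IsSetAlgebra 𝒜} {m : AddContent ℝ≥0 𝒜} {f : Ω → X}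

/-! ### The homomorphism of the completion into the clopen algebra -/

/-- The element `1_A` of `Λ_b(m, f)`, for `A` in the completion. -/
noncomputable def indB (hm : m univ = 1) (f : Ω → X) (A : completion h𝒜 m) : LamB h𝒜 m f :=
  ⟨fun p => (A : Set Ω).indicator (fun _ => 1) p.1,
    (mem_completion_iff_isL1_indicator h𝒜 hm).1 A.2, 1, fun p => by
      by_cases h : p.1 ∈ (A : Set Ω) <;> simp [h]⟩

theorem indB_apply (hm : m univ = 1) (A : completion h𝒜 m) (p : Ω × X) :
    (indB hm f A : Ω × X → ℝ) p = (A : Set Ω).indicator (fun _ => 1) p.1 := rfl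

theorem indB_eq_zero_or_one (hm : m univ = 1) (A : completion h𝒜 m) (p : Ω × X) :
    (indB hm f A : Ω × X → ℝ) p = 0 ∨ (indB hm f A : Ω × X → ℝ) p = 1 := by
  by_cases h : p.1 ∈ (A : Set Ω) <;> simp [indB_apply, h]

/-- The Boolean homomorphism `A ↦ {s : 1_A(s) = 1}`. -/
noncomputable def chi (h𝒜 : IsSetAlgebra 𝒜) (hm : m univ = 1) (f : Ω → X) :
    BoundedLatticeHom (completion h𝒜 m) (TopologicalSpace.Clopens (Spec (LamB h𝒜 m f))) where
  toFun A := ⟨{s | gel _ (indB hm f A) s = 1}, isClopen_gel_eq_one (indB_eq_zero_or_one hm A)⟩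
  map_sup' A B := by
    ext s
    -- Union is the maximum of indicators, an identity which passes from Ω × X to the spectrum.
    have h := gel_map₂ (indB hm f A) (indB hm f B) (indB hm f (A ⊔ B)) (φ := max)
      (by fun_prop) (fun p => by
        have : ((A ⊔ B : completion h𝒜 m) : Set Ω) = (A : Set Ω) ∪ B := rfl
        by_cases h1 : p.1 ∈ (A : Set Ω) <;> by_cases h2 : p.1 ∈ (B : Set Ω) <;>
          simp [indB_apply, this, h1, h2]) s
    change gel _ _ s = 1 ↔ gel _ _ s = 1 ∨ gel _ _ s = 1
    rw [h]
    rcases gel_eq_zero_or_one (indB_eq_zero_or_one hm A) s with h1 | h1 <;>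
      rcases gel_eq_zero_or_one (indB_eq_zero_or_one hm B) s with h2 | h2 <;> simp [h1, h2]
  map_inf' A B := by
    ext s
    have h := gel_map₂ (indB hm f A) (indB hm f B) (indB hm f (A ⊓ B)) (φ := min)
      (by fun_prop) (fun p => by
        have : ((A ⊓ B : completion h𝒜 m) : Set Ω) = (A : Set Ω) ∩ B := rfl
        by_cases h1 : p.1 ∈ (A : Set Ω) <;> by_cases h2 : p.1 ∈ (B : Set Ω) <;>
          simp [indB_apply, this, h1, h2]) s
    change gel _ _ s = 1 ↔ gel _ _ s = 1 ∧ gel _ _ s = 1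
    rw [h]
    rcases gel_eq_zero_or_one (indB_eq_zero_or_one hm A) s with h1 | h1 <;>
      rcases gel_eq_zero_or_one (indB_eq_zero_or_one hm B) s with h2 | h2 <;> simp [h1, h2]
  map_top' := by
    ext s
    have : indB hm f (⊤ : completion h𝒜 m) = 1 := by
      ext p
      have : ((⊤ : completion h𝒜 m) : Set Ω) = univ := rfl
      simp [indB_apply, this]
    change gel _ _ s = 1 ↔ True
    rw [this, map_one]
    simp
  map_bot' := by
    ext s
    have : indB hm f (⊥ : completion h𝒜 m) = 0 := by
      ext p
      have : ((⊥ : completion h𝒜 m) : Set Ω) = ∅ := rfl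
      simp [indB_apply, this]
    change gel _ _ s = 1 ↔ False
    rw [this, map_zero]
    simp

theorem gel_indB (hm : m univ = 1) (A : completion h𝒜 m) (s : Spec (LamB h𝒜 m f)) :
    gel _ (indB hm f A) s = (chi h𝒜 hm f A : Set (Spec (LamB h𝒜 m f))).indicator (fun _ => 1) s := by
  by_cases h : s ∈ (chi h𝒜 hm f A : Set (Spec (LamB h𝒜 m f)))
  · rw [indicator_of_mem h]
    exact h
  · rw [indicator_of_notMem h]
    exact (gel_eq_zero_or_one (indB_eq_zero_or_one hm A) s).resolve_right h

/-! ### Continuous functions and clopen sets -/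

variable {μ : Measure (Spec (LamB h𝒜 m f))} [IsProbabilityMeasure μ]

theorem integrable_gel (H : LamB h𝒜 m f) : Integrable (gel _ H) μ :=
  (gel _ H).continuous.integrable_of_hasCompactSupport (HasCompactSupport.of_compactSpace _)

/-- Only countably many level sets of H on the spectrum have positive measure, so some c in (a, b)
is a null level. Then 1_{H > c} belongs to Λ_b, and the corresponding clopen set lies between the
two superlevel sets. -/
theorem exists_clopen_between (hm : m univ = 1)
    (hμ : ∀ H : LamB h𝒜 m f, ∫ s, gel _ H s ∂μ = integ m (along f H))
    (H : LamB h𝒜 m f) {a b : ℝ} (hab : a < b) :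
    ∃ E : Set (Spec (LamB h𝒜 m f)), IsClopen E ∧ {s | b < gel _ H s} ⊆ E ∧ E ⊆ {s | a < gel _ H s} := by
  have hcount := Measure.countable_meas_level_set_pos (μ := μ) (gel _ H).continuous.measurable
  obtain ⟨c, hc, hcab⟩ : ∃ c ∈ {t | 0 < μ {s | gel _ H s = t}}ᶜ, c ∈ Ioo a b :=
    hcount.dense_compl ℝ |>.exists_mem_open isOpen_Ioo (nonempty_Ioo.2 hab)
  have hc0 : μ {s | gel _ H s = c} = 0 := by simpa using hc
  -- Transfer of the null level from μ back to m: the bands F n shrink to the level set, and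
  -- countable additivity makes their measures tend to 0.
  have hsmall : ∀ ε > 0, ∃ δ > 0, outer m {ω | |along f H ω - c| ≤ δ} < ε := by
    intro ε hε
    let F : ℕ → Set (Spec (LamB h𝒜 m f)) := fun n => {s | |gel _ H s - c| ≤ 2 / (n + 1)}
    have hlim : Tendsto (fun n => μ (F n)) atTop (𝓝 (μ (⋂ n, F n))) := by
      refine tendsto_measure_iInter_atTop (fun n => ?_) (fun i j hij s hs => ?_)
        ⟨0, measure_ne_top _ _⟩
      · exact (isClosed_le (by fun_prop) continuous_const).measurableSet.nullMeasurableSet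
      · refine le_trans (show |gel _ H s - c| ≤ 2 / (j + 1) from hs) ?_
        gcongr
    have hF : ⋂ n, F n ⊆ {s | gel _ H s = c} := by
      intro s hs
      have h1 : |gel _ H s - c| ≤ 0 := by
        have h2 : Tendsto (fun n : ℕ => 2 * (1 / ((n : ℝ) + 1))) atTop (𝓝 (2 * 0)) :=
          tendsto_one_div_add_atTop_nhds_zero_nat.const_mul 2
        rw [mul_zero] at h2
        refine ge_of_tendsto' h2 fun n => ?_
        rw [mul_one_div]
        exact mem_iInter.1 hs n
      exact sub_eq_zero.1 (abs_nonpos_iff.1 h1)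
    rw [measure_mono_null hF hc0] at hlim
    obtain ⟨n, hn⟩ := (hlim.eventually_lt_const
      (show (0 : ENNReal) < ENNReal.ofReal (ε / 4) by simpa using hε)).exists
    set δ : ℝ := 1 / (n + 1) with hδ
    have hδ0 : 0 < δ := by positivity
    refine ⟨δ, hδ0, ?_⟩
    -- A tent of height 2, at least 1 on the δ-band and zero beyond the 2δ-band F n. Its integral
    -- compares the two: half the outer measure of the δ-band is at most 2 μ(F n) < ε/2.
    let τ : ℝ → ℝ := fun x => max 0 (2 - |x - c| / δ)
    have hτ : Continuous τ := by fun_prop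
    have hτ0 : ∀ x, 0 ≤ τ x := fun x => le_max_left _ _
    have hτ2 : ∀ x, τ x ≤ 2 := fun x => max_le (by norm_num) (by
      have : 0 ≤ |x - c| / δ := by positivity
      linarith)
    have hτl : ∀ x, |x - c| ≤ δ → 1 ≤ τ x := fun x hx => le_max_of_le_right (by
      have : |x - c| / δ ≤ 1 := by rwa [div_le_one hδ0]
      linarith)
    have hτu : ∀ x, 2 / (n + 1) < |x - c| → τ x = 0 := fun x hx => max_eq_left (by
      have : 2 ≤ |x - c| / δ := by
        rw [le_div_iff₀ hδ0, hδ, mul_one_div]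
        exact hx.le
      linarith)
    let G : LamB h𝒜 m f := (gelEquiv h𝒜 hm f).symm ⟨fun s => τ (gel _ H s), by fun_prop⟩
    have hG : ∀ s, gel _ G s = τ (gel _ H s) := fun s =>
      DFunLike.congr_fun (gel_gelEquiv_symm hm _) s
    have hG' : ∀ ω, along f G ω = τ (along f H ω) := fun ω => hG (toSpec _ (ω, f ω))
    have h1 : integ m (along f G) ≤ 2 * μ.real (F n) := by
      rw [← hμ]
      have hFm : MeasurableSet (F n) := (isClosed_le (by fun_prop) continuous_const).measurableSet
      calc ∫ s, gel _ G s ∂μ ≤ ∫ s, (F n).indicator (fun _ => 2) s ∂μ := by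
            refine integral_mono (integrable_gel G) ((integrable_const _).indicator hFm) fun s => ?_
            by_cases h : s ∈ F n
            · simp only [indicator_of_mem h, hG]; exact hτ2 _
            · simp only [indicator_of_notMem h, hG]
              exact (hτu _ (not_le.1 h)).le
        _ = 2 * μ.real (F n) := by
            rw [integral_indicator hFm, setIntegral_const, smul_eq_mul, mul_comm]
    have h2 : μ.real (F n) < ε / 4 := by
      rw [Measure.real]
      exact (ENNReal.lt_ofReal_iff_toReal_lt (measure_ne_top _ _)).1 hn
    have h3 := mul_outer_le_integ h𝒜 hm G.2.1 (c := 1 / 2) (d := 3 / 4) (by norm_num) (by norm_num)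
    have h3' : (fun ω => |along f G ω|) = along f G := by
      ext ω; rw [hG', abs_of_nonneg (hτ0 _)]
    have h4 : outer m {ω | |along f H ω - c| ≤ δ} ≤ outer m {ω | 3 / 4 < |along f G ω|} :=
      outer_mono h𝒜 fun ω hω => by
        have := hτl (along f H ω) hω
        simp only [mem_ofPred_eq]
        rw [hG', abs_of_nonneg (hτ0 _)]
        linarith
    rw [h3'] at h3
    linarith
  let E' : Set (Ω × X) := {p | c < (H : Ω × X → ℝ) p}
  let G : LamB h𝒜 m f := ⟨E'.indicator fun _ => 1,
    (mem_completion_iff_isL1_indicator h𝒜 hm).1 (superlevel_mem_completion h𝒜 H.2.1 hsmall),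
    1, fun p => by by_cases h : p ∈ E' <;> simp [h]⟩
  have hG : ∀ p, (G : Ω × X → ℝ) p = E'.indicator (fun _ => 1) p := fun _ => rfl
  -- The strict inequality H > c is weakened so that the relation becomes closed and extends from Ω
  -- × X to the spectrum.
  have hrel : ∀ s, (gel _ G s = 1 ∧ c ≤ gel _ H s) ∨ (gel _ G s = 0 ∧ gel _ H s ≤ c) :=
    gel_mem_of_isClosed (fun i : Bool => cond i G H)
      (Q := {v | (v true = 1 ∧ c ≤ v false) ∨ (v true = 0 ∧ v false ≤ c)})
      (((isClosed_eq (continuous_apply _) continuous_const).inter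
        (isClosed_le continuous_const (continuous_apply _))).union
        ((isClosed_eq (continuous_apply _) continuous_const).inter
        (isClosed_le (continuous_apply _) continuous_const))) fun p => by
        by_cases h : p ∈ E'
        · exact Or.inl ⟨by simp [hG, h], le_of_lt h⟩
        · exact Or.inr ⟨by simp [hG, h], not_lt.1 h⟩
  refine ⟨{s | gel _ G s = 1}, isClopen_gel_eq_one fun p => ?_, fun s hs => ?_, fun s hs => ?_⟩
  · by_cases h : p ∈ E' <;> simp [hG, h]
  · rcases hrel s with h | h
    · exact h.1
    · exact absurd h.2 (not_le.2 (hcab.2.trans hs))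
  · rcases hrel s with h | h
    · exact hcab.1.trans_le h.2
    · exact absurd (h.1.symm.trans hs) zero_ne_one

/-- {φ > a} is the union over n of clopen sets squeezed between {φ > a + 1/(n+1)} and {φ > a}. -/
theorem measurable_clopen (hm : m univ = 1)
    (hμ : ∀ H : LamB h𝒜 m f, ∫ s, gel _ H s ∂μ = integ m (along f H))
    (φ : C(Spec (LamB h𝒜 m f), ℝ)) :
    Measurable[MeasurableSpace.generateFrom {E : Set (Spec (LamB h𝒜 m f)) | IsClopen E}] φ := by
  obtain ⟨H, rfl⟩ := (gel_lamB_bijective hm).2 φ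
  choose E hE hE1 hE2 using fun (a : ℝ) (n : ℕ) =>
    exists_clopen_between hm hμ H (lt_add_of_pos_right a (Nat.one_div_pos_of_nat (α := ℝ) (n := n)))
  refine @measurable_of_Ioi ℝ _ _ _ _ (MeasurableSpace.generateFrom _) _ _ _ _ fun a => ?_
  have : gel _ H ⁻¹' Ioi a = ⋃ n, E a n := by
    ext s
    simp only [mem_preimage, mem_Ioi, mem_iUnion]
    refine ⟨fun h => ?_, fun ⟨n, h⟩ => hE2 a n h⟩
    obtain ⟨n, hn⟩ := exists_nat_one_div_lt (sub_pos.2 h)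
    exact ⟨n, hE1 a n (by simp only [mem_ofPred_eq]; linarith)⟩
  rw [this]
  exact MeasurableSet.iUnion fun n => MeasurableSpace.measurableSet_generateFrom (hE a n)

/-- The indicator of E comes from some H ∈ Λ_b, and H(f) is the indicator of a set A in the
completion. H and 1_A need agree only along f, so the isometry identifies E and χ(A) up to a null
set and no better. -/
theorem exists_chi_symmDiff_null (hm : m univ = 1)
    (hμ : ∀ H : LamB h𝒜 m f, ∫ s, gel _ H s ∂μ = integ m (along f H))
    {E : Set (Spec (LamB h𝒜 m f))} (hE : IsClopen E) :
    ∃ A : completion h𝒜 m, μ (E ∆ (chi h𝒜 hm f A : Set (Spec (LamB h𝒜 m f)))) = 0 := by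
  classical
  obtain ⟨H, hH⟩ := (gel_lamB_bijective (h𝒜 := h𝒜) (f := f) hm).2
    ⟨E.indicator fun _ => 1, (hE.continuous_indicator continuous_const)⟩
  have hH' : ∀ s, gel _ H s = E.indicator (fun _ => 1) s := fun s => DFunLike.congr_fun hH s
  let A : Set Ω := {ω | along f H ω = 1}
  have hAi : A.indicator (fun _ => 1) = along f H := by
    ext ω
    have h : along f H ω = E.indicator (fun _ => 1) (toSpec _ (ω, f ω)) := hH' (toSpec _ (ω, f ω))
    by_cases h1 : ω ∈ A
    · rw [indicator_of_mem h1]; exact (show along f H ω = 1 from h1).symm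
    · rw [indicator_of_notMem h1]
      by_cases h2 : toSpec _ (ω, f ω) ∈ E
      · rw [indicator_of_mem h2] at h; exact absurd h h1
      · rw [indicator_of_notMem h2] at h; exact h.symm
  have hA : A ∈ completion h𝒜 m :=
    (mem_completion_iff_isL1_indicator h𝒜 hm).2 (by rw [hAi]; exact H.2.1)
  refine ⟨⟨A, hA⟩, ?_⟩
  have h0 : cls μ (H - indB hm f ⟨A, hA⟩) = 0 := by
    rw [← norm_eq_zero, map_sub, norm_cls_sub hμ]
    have : (fun ω => |along f H ω - along f (indB hm f ⟨A, hA⟩) ω|) = fun _ => 0 := by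
      ext ω
      have : along f (indB hm f ⟨A, hA⟩) ω = A.indicator (fun _ => 1) ω := rfl
      rw [this, hAi, sub_self, abs_zero]
    rw [this, integ_simple h𝒜 hm (isSimple_const h𝒜 0), simpleInt_const h𝒜 hm]
  have h1 := coeFn_cls μ (H - indB hm f ⟨A, hA⟩)
  rw [h0] at h1
  have h2 : ∀ᵐ s ∂μ, s ∉ E ∆ (chi h𝒜 hm f ⟨A, hA⟩ : Set (Spec (LamB h𝒜 m f))) := by
    filter_upwards [h1, Lp.coeFn_zero ℝ 1 μ] with s h3 h4
    rw [h4, map_sub, ContinuousMap.sub_apply, hH', gel_indB] at h3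
    rw [mem_symmDiff]
    by_cases h5 : s ∈ E <;>
      by_cases h6 : s ∈ (chi h𝒜 hm f ⟨A, hA⟩ : Set (Spec (LamB h𝒜 m f))) <;> simp_all
  simpa [ae_iff] using h2

/-! ### Properties of the extension of `cls` to `Λ(m, f)` -/

/-- Finitely many sequences which converge in `L¹` have a common subsequence along which all of
them converge almost everywhere. -/
theorem exists_common_subseq {S ι : Type*} [MeasurableSpace S] {ν : Measure S} [Fintype ι]
    {u : ι → ℕ → Lp ℝ 1 ν} {x : ι → Lp ℝ 1 ν} (h : ∀ i, Tendsto (u i) atTop (𝓝 (x i))) :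
    ∃ ns : ℕ → ℕ, StrictMono ns ∧
      ∀ᵐ s ∂ν, ∀ i, Tendsto (fun k => u i (ns k) s) atTop (𝓝 (x i s)) := by
  classical
  have key : ∀ t : Finset ι, ∃ ns : ℕ → ℕ, StrictMono ns ∧
      ∀ i ∈ t, ∀ᵐ s ∂ν, Tendsto (fun k => u i (ns k) s) atTop (𝓝 (x i s)) := fun t => by
    induction t using Finset.induction_on with
    | empty => exact ⟨id, strictMono_id, by simp⟩
    | insert i t _ ih =>
      obtain ⟨ns, hns, h1⟩ := ih
      obtain ⟨ks, hks, h2⟩ := (tendstoInMeasure_of_tendsto_Lp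
        ((h i).comp hns.tendsto_atTop)).exists_seq_tendsto_ae
      refine ⟨ns ∘ ks, hns.comp hks, fun j hj => ?_⟩
      rcases Finset.mem_insert.1 hj with rfl | hj
      · exact h2
      · filter_upwards [h1 j hj] with s hs
        exact hs.comp hks.tendsto_atTop
  obtain ⟨ns, hns, h1⟩ := key Finset.univ
  exact ⟨ns, hns, ae_all_iff.2 fun i => h1 i (Finset.mem_univ i)⟩

variable {hm : m univ = 1} {T : Lam h𝒜 m f →ₗ[ℝ] Lp ℝ 1 μ}

/-- `T` sends `H` to the limit of the classes of any sequence which determines `H(f)`. -/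
def Extends (hm : m univ = 1) (T : Lam h𝒜 m f →ₗ[ℝ] Lp ℝ 1 μ) : Prop :=
  ∀ (H : Lam h𝒜 m f) (s : ℕ → Ω → ℝ) (hs : IsDetermining m s (along f H)),
    Tendsto (fun n => cls μ ((hs.simple n).lift h𝒜 hm f)) atTop (𝓝 (T H))

/-- Consistency on bounded elements: the distance from the class of s_n to that of H is ∫|s_n -
H(f)| dm, which tends to 0. -/
theorem Extends.apply_coe (hT : Extends hm T)
    (hμ : ∀ H : LamB h𝒜 m f, ∫ s, gel _ H s ∂μ = integ m (along f H)) (H : LamB h𝒜 m f) :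
    T ⟨H, H.2.1⟩ = cls μ H := by
  obtain ⟨s, hs⟩ : IsL1 m (along f H) := H.2.1
  refine tendsto_nhds_unique (hT ⟨H, H.2.1⟩ s hs) (tendsto_iff_norm_sub_tendsto_zero.2 ?_)
  simp only [norm_cls_sub hμ]
  exact hs.tendsto_integ_abs_sub h𝒜 hm

theorem Extends.hasIntegral_abs (hT : Extends hm T)
    (hμ : ∀ H : LamB h𝒜 m f, ∫ s, gel _ H s ∂μ = integ m (along f H)) (H : Lam h𝒜 m f) :
    HasIntegral m |along f H| ‖T H‖ := by
  obtain ⟨s, hs⟩ := H.2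
  refine ⟨_, hs.abs h𝒜, ?_⟩
  have h : ∀ n, simpleInt m (fun ω => |s n ω|) = ‖cls μ ((hs.simple n).lift h𝒜 hm f)‖ := fun n => by
    rw [norm_cls hμ]
    exact (integ_simple h𝒜 hm ((hs.simple n).map h𝒜 abs)).symm
  simp only [h]
  exact (hT H s hs).norm

theorem Extends.norm_apply (hT : Extends hm T)
    (hμ : ∀ H : LamB h𝒜 m f, ∫ s, gel _ H s ∂μ = integ m (along f H)) (H : Lam h𝒜 m f) :
    ‖T H‖ = integ m fun ω => |along f H ω| := by
  obtain ⟨s, hs, h⟩ := hT.hasIntegral_abs hμ H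
  exact tendsto_nhds_unique h (hs.tendsto_integ h𝒜 hm)

/-- s_n ∨ t_n determines the supremum since max is Lipschitz, and the lattice operations of L¹ are
continuous. -/
theorem Extends.map_sup (hT : Extends hm T) (H G : Lam h𝒜 m f) :
    T ⟨H ⊔ G, sup_mem_Lam h𝒜 m f H.2 G.2⟩ = T H ⊔ T G := by
  obtain ⟨s, hs⟩ := H.2
  obtain ⟨t, ht⟩ := G.2
  have hd := hs.map₂ h𝒜 ht max 1 one_pos fun a b a' b' => by
    rw [one_mul]
    exact (abs_max_sub_max_le_max _ _ _ _).trans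
      (max_le_add_of_nonneg (abs_nonneg _) (abs_nonneg _))
  refine tendsto_nhds_unique (hT ⟨H ⊔ G, sup_mem_Lam h𝒜 m f H.2 G.2⟩ _ hd)
    (((hT H s hs).sup_nhds (hT G t ht)).congr fun n => ?_)
  refine Lp.ext ?_
  filter_upwards [coeFn_cls μ ((hs.simple n).lift h𝒜 hm f),
    coeFn_cls μ ((ht.simple n).lift h𝒜 hm f), coeFn_cls μ ((hd.simple n).lift h𝒜 hm f),
    Lp.coeFn_sup (cls μ ((hs.simple n).lift h𝒜 hm f)) (cls μ ((ht.simple n).lift h𝒜 hm f))]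
    with z h1 h2 h3 h4
  rw [h4, Pi.sup_apply, h1, h2, h3]
  exact (gel_map₂ _ _ _ (φ := max) (by fun_prop) (fun p => rfl) z).symm

theorem Extends.hasIntegral_indicator (hT : Extends hm T)
    (hμ : ∀ H : LamB h𝒜 m f, ∫ s, gel _ H s ∂μ = integ m (along f H))
    {A : Set Ω} (hA : A ∈ 𝒜) (H : Lam h𝒜 m f) :
    HasIntegral m (A.indicator (along f H))
      (∫ s in (chi h𝒜 hm f ⟨A, mem_completion h𝒜 m hA⟩ : Set (Spec (LamB h𝒜 m f))), T H s ∂μ) := by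
  obtain ⟨s, hs⟩ := H.2
  have hd := hs.indicator h𝒜 hA
  set A' : completion h𝒜 m := ⟨A, mem_completion h𝒜 m hA⟩
  refine ⟨_, hd, ?_⟩
  -- The formula for simple functions: the product 1_A s_n becomes the product of the continuous
  -- functions attached to 1_A and s_n, and the former is the indicator of χ(A).
  have h : ∀ n, simpleInt m (A.indicator (s n)) =
      ∫ z in (chi h𝒜 hm f A' : Set (Spec (LamB h𝒜 m f))),
        cls μ ((hs.simple n).lift h𝒜 hm f) z ∂μ := fun n => by
    have h1 : ∫ z, gel _ ((hd.simple n).lift h𝒜 hm f) z ∂μ = simpleInt m (A.indicator (s n)) :=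
      (hμ _).trans (integ_simple h𝒜 hm (hd.simple n))
    have hmeas : MeasurableSet (chi h𝒜 hm f A' : Set (Spec (LamB h𝒜 m f))) :=
      (chi h𝒜 hm f A').isClopen.isOpen.measurableSet
    rw [← h1, ← integral_indicator hmeas]
    refine integral_congr_ae ?_
    filter_upwards [coeFn_cls μ ((hs.simple n).lift h𝒜 hm f)] with z hz
    have h2 := gel_map₂ (indB hm f A') ((hs.simple n).lift h𝒜 hm f) ((hd.simple n).lift h𝒜 hm f)
      (φ := fun x y => x * y) (by fun_prop) (fun p => by
        change A.indicator (s n) p.1 = A.indicator (fun _ => 1) p.1 * s n p.1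
        by_cases h : p.1 ∈ A <;> simp [h]) z
    rw [h2, gel_indB]
    by_cases h3 : z ∈ (chi h𝒜 hm f A' : Set (Spec (LamB h𝒜 m f)))
    · rw [indicator_of_mem h3, indicator_of_mem h3, one_mul, hz]
    · rw [indicator_of_notMem h3, indicator_of_notMem h3, zero_mul]
  simp only [h]
  exact ((continuous_setIntegral _).tendsto _).comp (hT H s hs)

/-- The range contains the classes of all continuous functions, which are dense in L¹ of a regular
measure. -/
theorem Extends.denseRange (hT : Extends hm T) [μ.Regular]
    (hμ : ∀ H : LamB h𝒜 m f, ∫ s, gel _ H s ∂μ = integ m (along f H)) : DenseRange T := by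
  refine (ContinuousMap.toLp_denseRange ℝ μ ℝ (p := 1) ENNReal.one_ne_top).mono ?_
  rintro _ ⟨φ, rfl⟩
  obtain ⟨H, rfl⟩ := (gel_lamB_bijective hm).2 φ
  exact ⟨⟨H, H.2.1⟩, hT.apply_coe hμ H⟩

/-- The identity holds for the simple approximants and passes to the limit almost everywhere along a
subsequence common to all H_i and to their image under α; the latter is indexed by `none`. -/
theorem Extends.map_comp (hT : Extends hm T) {n : ℕ} (H : Fin n → Lam h𝒜 m f)
    (α : BoundedContinuousFunction (Fin n → ℝ) ℝ) :
    ∃ h : (fun p => α fun i => (H i : Ω × X → ℝ) p) ∈ Lam h𝒜 m f,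
      (fun s => α fun i => T (H i) s) =ᵐ[μ] T ⟨_, h⟩ := by
  choose s hs using fun i => (H i).2
  have hd := isDetermining_comp h𝒜 hm hs α
  refine ⟨⟨_, hd⟩, ?_⟩
  set G : Lam h𝒜 m f := ⟨fun p => α fun i => (H i : Ω × X → ℝ) p, _, hd⟩
  let u : Option (Fin n) → ℕ → LamB h𝒜 m f := fun o k =>
    o.elim ((hd.simple k).lift h𝒜 hm f) fun i => ((hs i).simple k).lift h𝒜 hm f
  obtain ⟨ns, -, hns⟩ := exists_common_subseq (u := fun o k => cls μ (u o k))
    (x := fun o => o.elim (T G) fun i => T (H i)) (by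
      rintro (_ | i)
      · exact hT G _ hd
      · exact hT (H i) _ (hs i))
  have hu : ∀ᵐ z ∂μ, ∀ o k, cls μ (u o k) z = gel _ (u o k) z :=
    ae_all_iff.2 fun o => ae_all_iff.2 fun k => coeFn_cls μ (u o k)
  filter_upwards [hns, hu] with z h1 h2
  refine tendsto_nhds_unique ((α.continuous.tendsto _).comp
    (tendsto_pi_nhds.2 fun i => h1 (some i))) ((h1 none).congr fun k => ?_)
  simp only [Function.comp_apply, h2]
  exact gel_pi (fun i => u (some i) (ns k)) (u none (ns k)) α.continuous (fun p => rfl) z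

/-! ### Pointwise versions of T(H) and null sets. -/

/-- The truncation of `H ∈ Λ(m, f)` at the levels `±n`. -/
def trunc (H : Lam h𝒜 m f) (n : ℕ) : LamB h𝒜 m f :=
  ⟨fun p => max (-(n : ℝ)) (min n ((H : Ω × X → ℝ) p)),
    IsL1.map₂ h𝒜 H.2 H.2 (fun a _ => max (-(n : ℝ)) (min n a)) 1 one_pos fun a b a' b' => by
      rw [one_mul]
      refine (abs_max_sub_max_le_max _ _ _ _).trans ?_
      rw [sub_self, abs_zero]
      refine max_le (by positivity) ((abs_min_sub_min_le_max _ _ _ _).trans ?_)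
      rw [sub_self, abs_zero]
      exact max_le (by positivity) (le_add_of_nonneg_right (abs_nonneg _)),
    n, fun p => abs_le.2 ⟨le_max_left _ _, max_le (by linarith [n.cast_nonneg (α := ℝ)]) (min_le_left _ _)⟩⟩

theorem trunc_apply (H : Lam h𝒜 m f) (n : ℕ) (p : Ω × X) :
    (trunc H n : Ω × X → ℝ) p = max (-(n : ℝ)) (min n ((H : Ω × X → ℝ) p)) := rfl

theorem abs_trunc_le (H : Lam h𝒜 m f) (n : ℕ) (p : Ω × X) :
    |(trunc H n : Ω × X → ℝ) p| ≤ |(H : Ω × X → ℝ) p| := by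
  rw [trunc_apply, abs_le]
  have hn : (0 : ℝ) ≤ n := n.cast_nonneg
  have h1 := neg_abs_le ((H : Ω × X → ℝ) p)
  have h2 := le_abs_self ((H : Ω × X → ℝ) p)
  have h3 := abs_nonneg ((H : Ω × X → ℝ) p)
  exact ⟨le_max_of_le_right (le_min (by linarith) h1),
    max_le (by linarith) ((min_le_right _ _).trans h2)⟩

theorem tendsto_clamp (x : ℝ) :
    Tendsto (fun n : ℕ => max (-(n : ℝ)) (min n x)) atTop (𝓝 x) := by
  obtain ⟨N, hN⟩ := exists_nat_ge |x|
  refine tendsto_const_nhds.congr' ?_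
  filter_upwards [eventually_ge_atTop N] with n hn
  have := abs_le.1 (hN.trans (Nat.cast_le.2 hn))
  rw [min_eq_right this.2, max_eq_right this.1]

/-- The version of `T H` given by the pointwise limit of the truncations of `H`. -/
noncomputable def version (H : Lam h𝒜 m f) (s : Spec (LamB h𝒜 m f)) : ℝ :=
  limUnder atTop fun n => gel _ (trunc H n) s

/-- At each point the truncations are clamps of one real number, hence eventually constant; this
gives equality everywhere, not merely a.e. -/
theorem version_coe (H : LamB h𝒜 m f) :
    version (⟨H, H.2.1⟩ : Lam h𝒜 m f) = gel _ H := by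
  ext s
  have h : ∀ n, gel _ (trunc (⟨H, H.2.1⟩ : Lam h𝒜 m f) n) s =
      max (-(n : ℝ)) (min n (gel _ H s)) := fun n =>
    gel_map H _ (φ := fun x => max (-(n : ℝ)) (min n x)) (by fun_prop) (fun p => rfl) s
  simp only [version, h]
  exact (tendsto_clamp _).limUnder_eq

theorem version_eq_zero {H : Lam h𝒜 m f} {s : Spec (LamB h𝒜 m f)}
    (h : ∀ n, gel _ (trunc H n) s = 0) : version H s = 0 := by
  simp only [version, h]
  exact tendsto_const_nhds.limUnder_eq

/-- Clamping is bounded and continuous, so a.e. every truncation is the clamp of the real number T H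
s, and these converge. Where the truncations diverge, `limUnder` takes an unspecified value, but
only on a null set. -/
theorem Extends.version_ae_eq (hT : Extends hm T)
    (hμ : ∀ H : LamB h𝒜 m f, ∫ s, gel _ H s ∂μ = integ m (along f H)) (H : Lam h𝒜 m f) :
    version H =ᵐ[μ] T H := by
  have h : ∀ᵐ s ∂μ, ∀ n : ℕ, gel _ (trunc H n) s = max (-(n : ℝ)) (min n (T H s)) := by
    refine ae_all_iff.2 fun n => ?_
    let α : BoundedContinuousFunction (Fin 1 → ℝ) ℝ :=
      BoundedContinuousFunction.ofNormedAddCommGroup (fun v => max (-(n : ℝ)) (min n (v 0)))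
        (by fun_prop) n fun v => abs_le.2 ⟨le_max_left _ _,
          max_le (by linarith [n.cast_nonneg (α := ℝ)]) (min_le_left _ _)⟩
    obtain ⟨h, h1⟩ := hT.map_comp (fun _ => H) α
    filter_upwards [h1, coeFn_cls μ (trunc H n)] with s h2 h3
    rw [← hT.apply_coe hμ] at h3
    exact h3.symm.trans h2.symm
  filter_upwards [h] with s hs
  simp only [version, hs]
  exact (tendsto_clamp _).limUnder_eq

/-- Nullness on A is turned into nullness everywhere of G = min(|H|, 1_A, 1), to which the isometry
applies. T maps G to min(|T H|, 1_{χ(A)}, 1) because α is bounded and continuous. -/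
theorem Extends.nullOn_iff (hT : Extends hm T)
    (hμ : ∀ H : LamB h𝒜 m f, ∫ s, gel _ H s ∂μ = integ m (along f H))
    (A : completion h𝒜 m) (H : Lam h𝒜 m f) :
    NullOn m (along f H) A ↔ ∀ᵐ s ∂μ, s ∈ chi h𝒜 hm f A → T H s = 0 := by
  let α : BoundedContinuousFunction (Fin 2 → ℝ) ℝ :=
    BoundedContinuousFunction.ofNormedAddCommGroup (fun v => min (min |v 0| |v 1|) 1)
      (by fun_prop) 1 fun v => abs_le.2 ⟨by
        have : 0 ≤ min (min |v 0| |v 1|) 1 := by positivity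
        linarith, min_le_right _ _⟩
  obtain ⟨h, h1⟩ := hT.map_comp ![H, ⟨indB hm f A, (indB hm f A).2.1⟩] α
  set G : Lam h𝒜 m f := ⟨_, h⟩
  have hG : ∀ ω, along f G ω =
      min (min |along f H ω| |(A : Set Ω).indicator (fun _ => 1) ω|) 1 := fun ω => rfl
  have hmem : ∀ ω ∈ (A : Set Ω), |along f G ω| = min |along f H ω| 1 := fun ω hω => by
    rw [hG, indicator_of_mem hω, abs_one, min_assoc, min_self, abs_of_nonneg (by positivity)]
  have hnot : ∀ ω ∉ (A : Set Ω), along f G ω = 0 := fun ω hω => by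
    rw [hG, indicator_of_notMem hω, abs_zero, min_eq_right (abs_nonneg (along f H ω)), min_eq_left zero_le_one]
  have e1 : NullOn m (along f H) A ↔ NullOn m (along f G) univ := by
    constructor
    · intro h c hc
      refine le_antisymm ((outer_mono h𝒜 fun ω hω => ?_).trans (h c hc).le) (outer_nonneg _ _)
      have hω' : c < |along f G ω| := hω.2
      have hA : ω ∈ (A : Set Ω) := by
        by_contra hn
        rw [hnot ω hn, abs_zero] at hω'
        exact absurd hω' (not_lt.2 hc.le)
      rw [hmem ω hA] at hω'
      exact ⟨hA, hω'.trans_le (min_le_left _ _)⟩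
    · intro h c hc
      refine le_antisymm ((outer_mono h𝒜 fun ω hω => ?_).trans
        -- As G never exceeds 1, the level must be lowered below 1 for its superlevel set to see
        -- that of H.
        (h (min c (1 / 2)) (by positivity)).le) (outer_nonneg _ _)
      refine ⟨trivial, ?_⟩
      simp only [mem_ofPred_eq]
      rw [hmem ω hω.1]
      exact lt_min ((min_le_left _ _).trans_lt hω.2) ((min_le_right _ _).trans_lt (by norm_num))
  have e2 : NullOn m (along f G) univ ↔ T G = 0 := by
    rw [nullOn_univ_iff h𝒜 hm G.2, ← hT.norm_apply hμ, norm_eq_zero]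
  have h2 := coeFn_cls μ (indB hm f A)
  rw [← hT.apply_coe hμ] at h2
  have h3 : ∀ᵐ s ∂μ, T G s = 0 ↔ (s ∈ chi h𝒜 hm f A → T H s = 0) := by
    filter_upwards [h1, h2] with s h4 h5
    rw [← h4]
    change min (min |T H s| |T ⟨indB hm f A, (indB hm f A).2.1⟩ s|) 1 = 0 ↔ _
    rw [h5, gel_indB]
    by_cases h6 : s ∈ chi h𝒜 hm f A
    · rw [indicator_of_mem (SetLike.mem_coe.2 h6), abs_one, min_assoc, min_self]
      refine ⟨fun h _ => ?_, fun h => by simp [h h6]⟩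
      by_contra hn
      exact absurd h (lt_min (abs_pos.2 hn) one_pos).ne'
    · rw [indicator_of_notMem (by exact h6), abs_zero, min_eq_right (abs_nonneg (T H s))]
      simp [h6]
  rw [e1, e2, Lp.eq_zero_iff_ae_eq_zero]
  constructor
  · intro h
    filter_upwards [h, h3] with s h4 h5 using h5.1 h4
  · intro h
    filter_upwards [h, h3] with s h4 h5 using h5.2 h4

/-- The intersection may be uncountable. Yet if the version of H is nonzero at s, so is some
truncation, which is continuous and again null on A. The exceptional set thus lies in a union of
open null sets; each compact subset of it is covered by finitely many, and inner regularity makes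
the union null. -/
theorem Extends.measure_sdiff_null (hT : Extends hm T) [μ.Regular]
    (hμ : ∀ H : LamB h𝒜 m f, ∫ s, gel _ H s ∂μ = integ m (along f H)) (A : completion h𝒜 m) :
    μ ((chi h𝒜 hm f A : Set (Spec (LamB h𝒜 m f))) \ ((chi h𝒜 hm f A : Set (Spec (LamB h𝒜 m f))) ∩
      ⋂ H ∈ {H : Lam h𝒜 m f | NullOn m (along f H) A}, {s | version H s = 0})) = 0 := by
  let O : Set (Spec (LamB h𝒜 m f)) := ⋃ H ∈ {H : LamB h𝒜 m f | NullOn m (along f H) A},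
    (chi h𝒜 hm f A : Set (Spec (LamB h𝒜 m f))) ∩ {s | gel _ H s ≠ 0}
  have hopen : ∀ H : LamB h𝒜 m f,
      IsOpen ((chi h𝒜 hm f A : Set (Spec (LamB h𝒜 m f))) ∩ {s | gel _ H s ≠ 0}) := fun H =>
    (chi h𝒜 hm f A).isClopen.isOpen.inter (isOpen_ne_fun (gel _ H).continuous continuous_const)
  have hO : IsOpen O := isOpen_biUnion fun H _ => hopen H
  have hnull : ∀ H : LamB h𝒜 m f, NullOn m (along f H) A →
      μ ((chi h𝒜 hm f A : Set (Spec (LamB h𝒜 m f))) ∩ {s | gel _ H s ≠ 0}) = 0 := fun H hH => by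
    have h1 := (hT.nullOn_iff hμ A ⟨H, H.2.1⟩).1 hH
    rw [hT.apply_coe hμ] at h1
    refine measure_eq_zero_iff_ae_notMem.2 ?_
    filter_upwards [h1, coeFn_cls μ H] with s h2 h3 h4
    exact h4.2 (h3 ▸ h2 h4.1)
  have hO0 : μ O = 0 := by
    rw [hO.measure_eq_iSup_isCompact]
    simp only [ENNReal.iSup_eq_zero]
    intro K hK hKc
    refine hKc.measure_zero_of_nhdsWithin fun s hs => ?_
    obtain ⟨H, hH, hsH⟩ := mem_iUnion₂.1 (hK hs)
    exact ⟨_, mem_nhdsWithin_of_mem_nhds ((hopen H).mem_nhds hsH), hnull H hH⟩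
  refine measure_mono_null (fun s hs => ?_) hO0
  obtain ⟨h1, h2⟩ := hs
  have h3 : ∃ H : Lam h𝒜 m f, NullOn m (along f H) A ∧ version H s ≠ 0 := by
    by_contra! hn
    exact h2 (mem_inter h1 (mem_iInter₂.2 hn))
  obtain ⟨H, hH, hs⟩ := h3
  obtain ⟨n, hn⟩ : ∃ n, gel _ (trunc H n) s ≠ 0 := by
    by_contra! hn
    exact hs (version_eq_zero hn)
  refine mem_iUnion₂.2 ⟨trunc H n, fun c hc => ?_, h1, hn⟩
  have hsub : (A : Set Ω) ∩ {ω | c < |along f (trunc H n) ω|} ⊆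
      (A : Set Ω) ∩ {ω | c < |along f H ω|} := fun ω hω =>
    ⟨hω.1, lt_of_lt_of_le hω.2 (abs_trunc_le H n _)⟩
  exact le_antisymm ((outer_mono h𝒜 hsub).trans (hH c hc).le) (outer_nonneg _ _)

end Representation
end FinAdd

theorem lemma5p2 {Ω : Type u} {X : Type v} [NormedAddCommGroup X] [NormedSpace ℝ X]
    [CompleteSpace X] {𝒜 : Set (Set Ω)} (h𝒜 : IsSetAlgebra 𝒜) (m : AddContent ℝ≥0 𝒜)
    (hm : m univ = 1) (f : Ω → X) :
    ∃ (S : Type (max u v)) (_ : TopologicalSpace S) (_ : CompactSpace S) (_ : T2Space S)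
      (_ : MeasurableSpace S) (_ : BorelSpace S)
      (lam : Measure S) (_ : IsProbabilityMeasure lam) (_ : lam.Regular)
      (χ : BoundedLatticeHom (FinAdd.completion h𝒜 m) (TopologicalSpace.Clopens S))
      (T : FinAdd.Lam h𝒜 m f →ₗ[ℝ] Lp ℝ 1 lam)
      -- `V H` is the chosen version of the class `T H`
      (V : FinAdd.Lam h𝒜 m f → S → ℝ),
      (∀ H, V H =ᵐ[lam] T H) ∧
      -- `T` is isometric: `‖T H‖ = ∫ |H(f)| dm`
      (∀ H : FinAdd.Lam h𝒜 m f, FinAdd.HasIntegral m |FinAdd.along f H| ‖T H‖) ∧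
      -- `T` is a lattice homomorphism
      (∀ H G : FinAdd.Lam h𝒜 m f,
        T ⟨H ⊔ G, FinAdd.sup_mem_Lam h𝒜 m f H.2 G.2⟩ = T H ⊔ T G) ∧
      -- `∫_A H(f) dm = ∫_{χ(A)} T(H) dλ`
      (∀ (A : Set Ω) (hA : A ∈ 𝒜) (H : FinAdd.Lam h𝒜 m f),
        FinAdd.HasIntegral m (A.indicator (FinAdd.along f H))
          (∫ s in (χ ⟨A, FinAdd.mem_completion h𝒜 m hA⟩ : Set S), T H s ∂lam)) ∧
      -- (a) `T` is an algebra isomorphism of `Λ_b(m, f)` onto `C(S)`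
      (∃ U : FinAdd.LamB h𝒜 m f ≃ₐ[ℝ] C(S, ℝ),
        ∀ H : FinAdd.LamB h𝒜 m f, V ⟨H, H.2.1⟩ = U H) ∧
      -- (b) continuous functions are measurable for the σ-algebra generated by clopen sets
      (∀ g : C(S, ℝ), Measurable[MeasurableSpace.generateFrom {E : Set S | IsClopen E}] g) ∧
      -- (c) clopen sets are, up to null sets, in the image of `χ`
      (∀ E : Set S, IsClopen E → ∃ A : FinAdd.completion h𝒜 m, lam (E ∆ (χ A : Set S)) = 0) ∧
      -- (d) dense range
      DenseRange T ∧
      -- (e) `α(T H₁, …, T Hₙ) = T(α(H₁, …, Hₙ))` a.s.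
      (∀ (n : ℕ) (H : Fin n → FinAdd.Lam h𝒜 m f) (α : BoundedContinuousFunction (Fin n → ℝ) ℝ),
        ∃ h : (fun p => α fun i => (H i : Ω × X → ℝ) p) ∈ FinAdd.Lam h𝒜 m f,
          (fun s => α fun i => T (H i) s) =ᵐ[lam] T ⟨_, h⟩) ∧
      -- (f) null sets
      (∀ (A : FinAdd.completion h𝒜 m) (H : FinAdd.Lam h𝒜 m f),
        FinAdd.NullOn m (FinAdd.along f H) A ↔ ∀ᵐ s ∂lam, s ∈ χ A → T H s = 0) ∧
      (∀ A : FinAdd.completion h𝒜 m,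
        lam ((χ A : Set S) \ ((χ A : Set S) ∩
          ⋂ H ∈ {H : FinAdd.Lam h𝒜 m f | FinAdd.NullOn m (FinAdd.along f H) A},
            {s | V H s = 0})) = 0) := by
  obtain ⟨μ, hprob, hreg, hμ⟩ := FinAdd.exists_representing_measure h𝒜 hm f
  obtain ⟨T, hT⟩ := FinAdd.exists_extension (f := f) hm hμ
  have hT : FinAdd.Extends hm T := hT
  exact ⟨FinAdd.Spec (FinAdd.LamB h𝒜 m f), inferInstance, inferInstance, inferInstance,
    inferInstance, inferInstance, μ, hprob, hreg, FinAdd.chi h𝒜 hm f, T, FinAdd.version,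
    hT.version_ae_eq hμ, hT.hasIntegral_abs hμ, hT.map_sup,
    fun A hA H => hT.hasIntegral_indicator hμ hA H,
    ⟨FinAdd.gelEquiv h𝒜 hm f, FinAdd.version_coe⟩, FinAdd.measurable_clopen hm hμ,
    fun E hE => FinAdd.exists_chi_symmDiff_null hm hμ hE, hT.denseRange hμ,
    fun n H α => hT.map_comp H α, hT.nullOn_iff hμ, hT.measure_sdiff_null hμ⟩
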